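/- Let $k,m\ge 1$, let $d_1,\dots,d_k$ and $n_1,\dots,n_m$ be positive integers, and let $\mathbf p=(p_1,\dots,p_m)$ be positive real numbers with $\sum_{i=1}^k d_i=\sum_{j=1}^m p_jn_j$. For each $(i,j)\in[k]\times[m]$ let $\mathscr A_{ij}$ be a finite set. For a tuple of matrices $$V=(V_a)\in\mathbb R^{D_1}:=\prod_{i,j}\prod_{a\in\mathscr A_{ij}}\mathbb R^{n_j\times d_i}$$ and a tuple $Y=(Y_j)\in\mathbb R^{D_2}:=\prod_{j}\mathbb R^{n_j\times n_j}$ put $$M_i=M_i(V,Y):=\sum_{j=1}^m p_j\sum_{a\in\mathscr A_{ij}}V_a^{\top}Y_jV_a\qquad(i\in[k]).$$ Let $\mathsf{PD}_{n}$ be the set of real symmetric positive definite $n\times n$ matrices, and define the capacity $$\mathbf{cap}(V,\mathbf p):=\inf\left\{\frac{\prod_{i=1}^k\det M_i(V,Y)}{\prod_{j=1}^m\det(Y_j)^{p_j}}\;\middle|\;Y\in\prod_{j=1}^m\mathsf{PD}_{n_j}\right\}.$$ Call $(V,\mathbf p)$ extremizable if $\mathbf{cap}(V,\mathbf p)>0$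 and this infimum is attained at some $Y\in\prod_j\mathsf{PD}_{n_j}$, and let $\mathscr V\subseteq\mathbb R^{D_1}$ be the set of all $V$ such that $(V,\mathbf p)$ is extremizable. Let $\mathscr X\subseteq\mathbb R^{D_1}\times\mathbb R^{D_2}$ be the set of all pairs $(V,Y)$ with $Y\in\prod_j\mathsf{PD}_{n_j}$ such that $M_i$ is invertible for all $i\in[k]$ and $$\sum_{i=1}^k\sum_{a\in\mathscr A_{ij}}V_aM_i^{-1}V_a^{\top}=Y_j^{-1}\qquad\text{for all }j\in[m].$$ A subset of $\mathbb R^D$ is called semi-algebraic if it is a finite union of sets, each defined by finitely many polynomial equalities and strict inequalities. **Theorem.** The set $\mathscr X$ is semi-algebraic, and $\mathscr V=\pi_1(\mathscr X)$, where $\pi_1:\mathbb R^{D_1}\times\mathbb R^{D_2}\to\mathbb R^{D_1}$ is the projection; $\mathscr V$ is therefore a semi-algebraic set. Furthermore, for all $(V,Y)\in\mathscr X$, $$\mathbf{cap}(V,\mathbf p)=\frac{\prod_{i=1}^k\det(M_i)}{\prod_{j=1}^m\det(Y_j)^{p_j}}.$$ -/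

import Mathlib

universe u

/-- A subset of `ℝ^ι` is semi-algebraic if it is a finite union of sets, each of them defined by
finitely many polynomial equations and finitely many strict polynomial inequalities. -/
def IsSemialgebraic {ι : Type*} (S : Set (ι → ℝ)) : Prop :=
  ∃ F : Finset (Finset (MvPolynomial ι ℝ) × Finset (MvPolynomial ι ℝ)),
    S = ⋃ c ∈ F, {x : ι → ℝ | (∀ f ∈ c.1, MvPolynomial.eval x f = 0) ∧
      (∀ g ∈ c.2, 0 < MvPolynomial.eval x g)}

namespace QuiverBL

/-- The space of tuples `V = (V_a)` of real matrices `V_a ∈ ℝ^{n_j × d_i}`, one for each arrow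
`a ∈ A i j` from the source vertex `i` to the sink vertex `j` of a bipartite quiver. -/
abbrev Rep {k m : ℕ} (d : Fin k → ℕ) (n : Fin m → ℕ) (A : Fin k → Fin m → Type u) : Type u :=
  ∀ (i : Fin k) (j : Fin m), A i j → Matrix (Fin (n j)) (Fin (d i)) ℝ

/-- The space of tuples `Y = (Y_j)` of real square matrices `Y_j ∈ ℝ^{n_j × n_j}`. -/
abbrev SinkTuple {m : ℕ} (n : Fin m → ℕ) : Type :=
  ∀ j : Fin m, Matrix (Fin (n j)) (Fin (n j)) ℝ

section Capacity

variable {k m : ℕ} {d : Fin k → ℕ} {n : Fin m → ℕ} {A : Fin k → Fin m → Type u}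
  [∀ i j, Fintype (A i j)]

/-- The matrix `M_i = ∑_j p_j ∑_{a ∈ A i j} V_aᵀ Y_j V_a`. -/
def sourceMatrix (p : Fin m → ℝ) (V : Rep d n A) (Y : SinkTuple n) (i : Fin k) :
    Matrix (Fin (d i)) (Fin (d i)) ℝ :=
  ∑ j, p j • ∑ a : A i j, (V i j a).transpose * Y j * V i j a

/-- The function `Y ↦ ∏_i det M_i / ∏_j (det Y_j)^{p_j}` that is minimized. -/
noncomputable def capacityRatio (p : Fin m → ℝ) (V : Rep d n A) (Y : SinkTuple n) : ℝ :=
  (∏ i, (sourceMatrix p V Y i).det) / ∏ j, (Y j).det ^ p j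

/-- The capacity of the quiver datum `(V, p)`: the infimum of the above function over all tuples
of (symmetric) positive definite matrices. -/
noncomputable def capacity (p : Fin m → ℝ) (V : Rep d n A) : ℝ :=
  sInf {r : ℝ | ∃ Y : SinkTuple n, (∀ j, (Y j).PosDef) ∧ r = capacityRatio p V Y}

/-- `(V, p)` is feasible if its capacity is positive. -/
def IsFeasible (p : Fin m → ℝ) (V : Rep d n A) : Prop :=
  0 < capacity p V

/-- `Y` is an extremizer for `(V, p)` if it is a tuple of positive definite matrices at which the
infimum in the definition of the capacity is attained. -/
def IsExtremizer (p : Fin m → ℝ) (V : Rep d n A) (Y : SinkTuple n) : Prop :=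
  (∀ j, (Y j).PosDef) ∧ capacityRatio p V Y = capacity p V

/-- `(V, p)` is extremizable if it is feasible and has an extremizer. -/
def IsExtremizable (p : Fin m → ℝ) (V : Rep d n A) : Prop :=
  IsFeasible p V ∧ ∃ Y : SinkTuple n, IsExtremizer p V Y

variable (d n A) in
/-- The set `𝒱` of all `V` for which `(V, p)` is extremizable. -/
def extremizableSet (p : Fin m → ℝ) : Set (Rep d n A) :=
  {V | IsExtremizable p V}

variable (d n A) in
/-- The set `𝒳` of all pairs `(V, Y)`, with all `Y_j` positive definite, such that all `M_i` are
invertible and `∑_i ∑_{a ∈ A i j} V_a M_i⁻¹ V_aᵀ = Y_j⁻¹` for all `j`. -/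
def fixedPointSet (p : Fin m → ℝ) : Set (Rep d n A × SinkTuple n) :=
  {q | (∀ j, (q.2 j).PosDef) ∧
    (∀ i, IsUnit (sourceMatrix p q.1 q.2 i)) ∧
    ∀ j, ∑ i, ∑ a : A i j,
      q.1 i j a * (sourceMatrix p q.1 q.2 i)⁻¹ * (q.1 i j a).transpose = (q.2 j)⁻¹}

end Capacity

section Coordinates

variable {k m : ℕ} (d : Fin k → ℕ) (n : Fin m → ℕ) (A : Fin k → Fin m → Type u)

/-- The index set of the `∑_{i,j} |A i j| d_i n_j` matrix entries of `V`. -/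
abbrev RepIndex : Type u :=
  Σ (i : Fin k) (j : Fin m), A i j × Fin (n j) × Fin (d i)

/-- The index set of the `∑_j n_j²` matrix entries of `Y`. -/
abbrev SinkIndex : Type :=
  Σ j : Fin m, Fin (n j) × Fin (n j)

/-- The identification of the space of all `V` with a coordinate space, by matrix entries. -/
def repCoords : Rep d n A ≃ (RepIndex d n A → ℝ) where
  toFun V x := V x.1 x.2.1 x.2.2.1 x.2.2.2.1 x.2.2.2.2
  invFun v i j a := Matrix.of fun r c => v ⟨i, j, a, r, c⟩
  left_inv _ := rfl
  right_inv _ := rfl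

/-- The identification of the space of all `Y` with a coordinate space, by matrix entries. -/
def sinkCoords : SinkTuple n ≃ (SinkIndex n → ℝ) where
  toFun Y x := Y x.1 x.2.1 x.2.2
  invFun y j := Matrix.of fun r c => y ⟨j, r, c⟩
  left_inv _ := rfl
  right_inv _ := rfl

/-- The identification of the space of all pairs `(V, Y)` with a coordinate space. -/
def pairCoords : Rep d n A × SinkTuple n ≃ (RepIndex d n A ⊕ SinkIndex n → ℝ) :=
  (Equiv.prodCongr (repCoords d n A) (sinkCoords n)).trans
    (Equiv.sumArrowEquivProdArrow (RepIndex d n A) (SinkIndex n) ℝ).symm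

end Coordinates

end QuiverBL

/-! There are two independent ingredients: a critical point analysis of the capacity, and quantifier
elimination over the reals.

Capacity. The equations defining `fixedPointSet` say that the logarithm of `capacityRatio` has
vanishing derivative at `Y` in every symmetric direction. An extremizer is an interior minimum, so
it satisfies them (`mem_fixedPointSet_of_isExtremizer`). Conversely, every critical point is a
global minimum (`capacityRatio_le_of_mem`). To compare `Y` with a competitor `Y'`, change bases so
that all `Y_j` and `M_i` become identities while the `Y'_j` and the matrices `M_i(V, Y')` become
diagonal. The datum is then geometric, its squared entries form probability weights, and concavity
of the logarithm gives the inequality (`sum_log_le_of_geometric`). The formula for the capacity and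
the equality of `extremizableSet` with the projection of `fixedPointSet` follow.

Semi-algebraicity. The exponents `p j` enter the fixed point equations only as real coefficients.
With auxiliary unknowns for the inverses of the `M_i` and for factors `Y_j = L_jᵀ L_j`, these
equations become polynomial (`mem_fixedPointSet_iff`). The unknowns are then eliminated by the
Tarski–Seidenberg theorem (`IsSemialgebraic.exists_sumElim`).

That theorem is proved in the manner of Cohen and Hörmander. A set is semi-algebraic iff membership
depends only on the signs of finitely many polynomials. For a finite family of univariate
polynomials with parameters, the signs of finitely many expressions in the parameters determine the
whole sign pattern along the line up to an increasing bijection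
(`exists_finset_forall_exists_orderIso`). This bijection carries a witness over one parameter to a
witness over the other. The induction on degree uses derivatives and pseudo-remainders: at a root of
`g`, the sign of `f` is that of its remainder modulo `g`; between consecutive roots of a family
containing the derivative, `f` is monotone, so its signs at the ends of the gap decide whether it
has a root there. -/

/-! ### Semi-algebraic sets as sets determined by finitely many signs -/

section SignDetermined

/-- Membership in `A` depends only on the signs of the polynomials in `C`. -/
def SignDetermined {ι : Type*} (C : Finset (MvPolynomial ι ℝ)) (A : Set (ι → ℝ)) : Prop :=
  ∀ x y : ι → ℝ, (∀ c ∈ C, SignType.sign (MvPolynomial.eval x c) =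
    SignType.sign (MvPolynomial.eval y c)) → x ∈ A → y ∈ A

variable {ι : Type*} {A B : Set (ι → ℝ)} {C C' : Finset (MvPolynomial ι ℝ)}

theorem SignDetermined.mono (h : SignDetermined C A) (hC : C ⊆ C') : SignDetermined C' A :=
  fun x y hxy => h x y fun c hc => hxy c (hC hc)

/-- There are finitely many sign vectors on `C`, and `A` is the union of the sign cells that it
meets. A cell is cut out by `c = 0` or `0 < ±c` for each `c ∈ C`. -/
theorem SignDetermined.isSemialgebraic (h : SignDetermined C A) : IsSemialgebraic A := by
  classical
  let F : (C → SignType) → Finset (MvPolynomial ι ℝ) × Finset (MvPolynomial ι ℝ) := fun s =>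
    ((Finset.univ.filter fun c => s c = 0).image (fun c : C => (c : MvPolynomial ι ℝ)),
      (Finset.univ.filter fun c => s c ≠ 0).image
        (fun c : C => if s c = 1 then (c : MvPolynomial ι ℝ) else -(c : MvPolynomial ι ℝ)))
  have hF : ∀ s x, ((∀ f ∈ (F s).1, MvPolynomial.eval x f = 0) ∧
      (∀ g ∈ (F s).2, 0 < MvPolynomial.eval x g)) ↔
      ∀ c : C, SignType.sign (MvPolynomial.eval x (c : MvPolynomial ι ℝ)) = s c := by
    intro s x
    simp only [F, Finset.mem_image, Finset.mem_filter, Finset.mem_univ, true_and,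
      forall_exists_index, and_imp]
    constructor
    · rintro ⟨h0, h1⟩ c
      rcases hs : s c with _ | _ | _
      · have := h0 c c hs rfl
        rw [this]; simp
      · have := h1 _ c (by rw [hs]; decide) rfl
        rw [hs, if_neg (by decide), map_neg] at this
        exact sign_neg (by linarith)
      · have := h1 _ c (by rw [hs]; decide) rfl
        rw [hs, if_pos (show SignType.pos = 1 from rfl)] at this
        exact sign_pos this
    · intro hs
      refine ⟨?_, ?_⟩
      · rintro f c hc rfl
        rw [← hs c, sign_eq_zero_iff] at hc
        exact hc
      · rintro g c hc rfl
        rw [← hs c] at hc ⊢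
        by_cases h1 : SignType.sign (MvPolynomial.eval x (c : MvPolynomial ι ℝ)) = 1
        · rw [if_pos h1]; exact sign_eq_one_iff.1 h1
        · rw [if_neg h1, map_neg]
          rcases lt_trichotomy (MvPolynomial.eval x (c : MvPolynomial ι ℝ)) 0 with h | h | h
          · linarith
          · simp [h] at hc
          · exact absurd (sign_pos h) h1
  refine ⟨(Finset.univ.filter fun s : C → SignType => ∃ x ∈ A, ∀ c : C,
    SignType.sign (MvPolynomial.eval x (c : MvPolynomial ι ℝ)) = s c).image F, ?_⟩
  ext y
  simp only [Set.mem_iUnion, Set.mem_ofPred_eq, Finset.mem_image, Finset.mem_filter,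
    Finset.mem_univ, true_and, exists_prop]
  constructor
  · intro hy
    exact ⟨_, ⟨fun c => SignType.sign (MvPolynomial.eval y (c : MvPolynomial ι ℝ)),
      ⟨y, hy, fun _ => rfl⟩, rfl⟩, (hF _ _).2 fun _ => rfl⟩
  · rintro ⟨_, ⟨s, ⟨x, hx, hxs⟩, rfl⟩, hy⟩
    exact h x y (fun c hc => (hxs ⟨c, hc⟩).trans ((hF _ _).1 hy ⟨c, hc⟩).symm) hx

theorem isSemialgebraic_iff_signDetermined :
    IsSemialgebraic A ↔ ∃ C : Finset (MvPolynomial ι ℝ), SignDetermined C A := by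
  classical
  refine ⟨?_, fun ⟨C, hC⟩ => hC.isSemialgebraic⟩
  rintro ⟨F, rfl⟩
  refine ⟨F.biUnion fun c => c.1 ∪ c.2, fun x y hxy hx => ?_⟩
  simp only [Set.mem_iUnion, Set.mem_ofPred_eq, exists_prop] at hx ⊢
  obtain ⟨c, hc, h0, h1⟩ := hx
  refine ⟨c, hc, fun f hf => ?_, fun g hg => ?_⟩
  · have := hxy f (Finset.mem_biUnion.2 ⟨c, hc, Finset.mem_union_left _ hf⟩)
    rw [h0 f hf, sign_zero] at this
    exact sign_eq_zero_iff.1 this.symm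
  · have := hxy g (Finset.mem_biUnion.2 ⟨c, hc, Finset.mem_union_right _ hg⟩)
    rw [sign_pos (h1 g hg)] at this
    exact sign_eq_one_iff.1 this.symm

theorem IsSemialgebraic.inter (hA : IsSemialgebraic A) (hB : IsSemialgebraic B) :
    IsSemialgebraic (A ∩ B) := by
  classical
  obtain ⟨C, hC⟩ := isSemialgebraic_iff_signDetermined.1 hA
  obtain ⟨C', hC'⟩ := isSemialgebraic_iff_signDetermined.1 hB
  refine SignDetermined.isSemialgebraic (C := C ∪ C') fun x y hxy hx => ⟨?_, ?_⟩
  · exact hC.mono Finset.subset_union_left x y hxy hx.1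
  · exact hC'.mono Finset.subset_union_right x y hxy hx.2

theorem IsSemialgebraic.iInter {β : Type*} [Finite β] {A : β → Set (ι → ℝ)}
    (hA : ∀ b, IsSemialgebraic (A b)) : IsSemialgebraic (⋂ b, A b) := by
  classical
  cases nonempty_fintype β
  choose C hC using fun b => isSemialgebraic_iff_signDetermined.1 (hA b)
  refine SignDetermined.isSemialgebraic (C := Finset.univ.biUnion C) fun x y hxy hx => ?_
  rw [Set.mem_iInter] at hx ⊢
  exact fun b => (hC b).mono (Finset.subset_biUnion_of_mem C (Finset.mem_univ b)) x y hxy (hx b)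

theorem IsSemialgebraic.preimage_comp {κ : Type*} (e : ι → κ) (hA : IsSemialgebraic A) :
    IsSemialgebraic {x : κ → ℝ | x ∘ e ∈ A} := by
  classical
  obtain ⟨C, hC⟩ := isSemialgebraic_iff_signDetermined.1 hA
  refine SignDetermined.isSemialgebraic (C := C.image (MvPolynomial.rename e))
    fun x y hxy hx => hC _ _ (fun c hc => ?_) hx
  have := hxy _ (Finset.mem_image_of_mem _ hc)
  rwa [MvPolynomial.eval_rename, MvPolynomial.eval_rename] at this

end SignDetermined

/-! ### Increasing bijections of the line supported in an interval -/

section Analysis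

theorem exists_orderIso_apply_eq_of_le {c u v d : ℝ} (hcu : c < u) (huv : u ≤ v) (hvd : v < d) :
    ∃ θ : ℝ ≃o ℝ, θ u = v ∧ ∀ t, t ∉ Set.Ioo c d → θ t = t := by
  have hud : u < d := huv.trans_lt hvd
  set k := (v - c) / (u - c) with hk
  set l := (d - v) / (d - u) with hl
  have hk1 : 1 ≤ k := by rw [hk, le_div_iff₀ (by linarith)]; linarith
  have hl0 : 0 < l := div_pos (by linarith) (by linarith)
  have hl1 : l ≤ 1 := by rw [hl, div_le_iff₀ (by linarith)]; linarith
  -- The two lines join `(u, v)` to `(c, c)` and to `(d, d)`. Their minimum lies on or below the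
  -- diagonal outside `(c, d)`, so the maximum with `t` is the identity there.
  let f : ℝ → ℝ := fun t => max t (min (c + (t - c) * k) (d - (d - t) * l))
  have hmono : StrictMono f := by
    intro s t hst
    refine max_lt_max hst (min_lt_min ?_ ?_)
    · nlinarith
    · nlinarith
  have hcont : Continuous f := by fun_prop
  have hle : ∀ t, t ≤ f t := fun t => le_max_left _ _
  have hout : ∀ t, t ∉ Set.Ioo c d → f t = t := by
    intro t ht
    refine max_eq_left ?_
    rcases le_or_gt t c with h | h
    · exact (min_le_left _ _).trans (by nlinarith)
    · have : d ≤ t := by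
        by_contra h'
        exact ht ⟨h, not_le.1 h'⟩
      exact (min_le_right _ _).trans (by nlinarith)
  have hsurj : Function.Surjective f := by
    refine hcont.surjective (Filter.tendsto_atTop_mono hle Filter.tendsto_id) ?_
    refine Filter.Tendsto.congr' ?_ Filter.tendsto_id
    filter_upwards [Filter.eventually_le_atBot c] with t ht
    exact (hout t fun h => absurd h.1 (not_lt.2 ht)).symm
  refine ⟨hmono.orderIsoOfSurjective f hsurj, ?_, hout⟩
  change max u (min (c + (u - c) * k) (d - (d - u) * l)) = v
  have h1 : (u - c) * k = v - c := by rw [hk]; field_simp [(by linarith : u - c ≠ 0)]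
  have h2 : (d - u) * l = d - v := by rw [hl]; field_simp [(by linarith : d - u ≠ 0)]
  rw [h1, h2]
  simp [huv]

theorem exists_orderIso_apply_eq {c u v d : ℝ} (hu : u ∈ Set.Ioo c d) (hv : v ∈ Set.Ioo c d) :
    ∃ θ : ℝ ≃o ℝ, θ u = v ∧ ∀ t, t ∉ Set.Ioo c d → θ t = t := by
  rcases le_total u v with h | h
  · exact exists_orderIso_apply_eq_of_le hu.1 h hv.2
  · obtain ⟨θ, h1, h2⟩ := exists_orderIso_apply_eq_of_le hv.1 h hu.2
    exact ⟨θ.symm, by rw [← h1, θ.symm_apply_apply],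
      fun t ht => by rw [θ.symm_apply_eq, h2 t ht]⟩

end Analysis

/-! ### Division with parameters -/

section PseudoRemainder

open Polynomial

/-- Pseudo-division by `g`, at all the specializations at which `g` has degree `k`. -/
theorem exists_pseudoRemainder {R : Type*} [CommRing R] (f g : R[X]) {k : ℕ} (hk : 0 < k) :
    ∃ r : R[X], r.natDegree < k ∧ ∀ φ : R →+* ℝ, (g.map φ).natDegree = k →
      ∃ c : ℝ, 0 < c ∧ ∀ t, (g.map φ).eval t = 0 → (r.map φ).eval t = c * (f.map φ).eval t := by
  induction hN : f.natDegree using Nat.strong_induction_on generalizing f with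
  | _ N ih =>
    subst hN
    rcases lt_or_ge f.natDegree k with hlt | hge
    · exact ⟨f, hlt, fun φ _ => ⟨1, one_pos, fun t _ => (one_mul _).symm⟩⟩
    set a := g.coeff k with ha
    -- Truncating `g` at degree `k` changes nothing under the specializations considered. The factor
    -- `a ^ 2`, rather than `a`, in `f₁` makes the multiplier of `f` positive after specialization,
    -- so that signs survive.
    set h : R[X] := ∑ i ∈ Finset.range (k + 1), C (g.coeff i) * X ^ i with hh
    set f₁ : R[X] := C (a ^ 2) * f - C (a * f.leadingCoeff) * X ^ (f.natDegree - k) * h with hf₁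
    have hhk : h.coeff k = a := by
      simp [hh, ha]
    have hhdeg : h.natDegree ≤ k := by
      refine natDegree_sum_le_of_forall_le _ _ fun i hi => ?_
      exact (natDegree_C_mul_X_pow_le _ _).trans (Nat.lt_succ_iff.1 (Finset.mem_range.1 hi))
    have hdeg : f₁.natDegree < f.natDegree := by
      have hle : f₁.natDegree ≤ f.natDegree := by
        refine (natDegree_sub_le _ _).trans (max_le (natDegree_C_mul_le _ _) ?_)
        refine natDegree_mul_le.trans ?_
        have := natDegree_C_mul_X_pow_le (a * f.leadingCoeff) (f.natDegree - k)
        omega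
      have hc : f₁.coeff f.natDegree = 0 := by
        have h2 : (C (a * f.leadingCoeff) * X ^ (f.natDegree - k) * h).coeff f.natDegree =
            a * f.leadingCoeff * a := by
          rw [mul_assoc, coeff_C_mul, coeff_X_pow_mul', if_pos (Nat.sub_le _ _),
            Nat.sub_sub_self hge, hhk]
        rw [hf₁, coeff_sub, h2, coeff_C_mul, coeff_natDegree]
        ring
      rcases hle.lt_or_eq with h' | h'
      · exact h'
      · rw [← h', coeff_natDegree, leadingCoeff_eq_zero] at hc
        rw [hc, natDegree_zero] at h'
        omega
    obtain ⟨r, hr, hr'⟩ := ih _ hdeg f₁ rfl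
    refine ⟨r, hr, fun φ hφ => ?_⟩
    obtain ⟨c, hc, hcr⟩ := hr' φ hφ
    have hφa : φ a ≠ 0 := by
      rw [ha, ← coeff_map, ← hφ, coeff_natDegree, Ne, leadingCoeff_eq_zero]
      rintro h0
      rw [h0, natDegree_zero] at hφ
      omega
    have hgh : h.map φ = g.map φ := by
      conv_rhs => rw [as_sum_range_C_mul_X_pow (g.map φ), hφ]
      simp [hh, Polynomial.map_sum]
    refine ⟨c * φ a ^ 2, by positivity, fun t ht => ?_⟩
    rw [hcr t ht, hf₁]
    simp only [Polynomial.map_sub, Polynomial.map_mul, map_C, hgh, eval_sub, eval_mul, ht, eval_C,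
      map_pow, Polynomial.map_pow, eval_pow]
    ring

end PseudoRemainder

/-! ### Signs of a polynomial on the gaps between the roots of a family -/

section Refinement

open Polynomial

/-- The points that are not separated from `t` by a point of `S`. -/
def gapAround (S : Finset ℝ) (t : ℝ) : Set ℝ :=
  {s | ∀ a ∈ S, a ∉ Set.uIcc s t}

theorem self_mem_gapAround {S : Finset ℝ} {t : ℝ} (ht : t ∉ S) : t ∈ gapAround S t := by
  intro a ha hat
  rw [Set.uIcc_self, Set.mem_singleton_iff] at hat
  exact ht (hat ▸ ha)

theorem notMem_of_mem_gapAround {S : Finset ℝ} {s t : ℝ} (hs : s ∈ gapAround S t) : s ∉ S :=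
  fun h => hs s h Set.left_mem_uIcc

/-- The interval contains its endpoint `t`, so the gap around a point of `S` is empty. -/
theorem notMem_center_of_mem_gapAround {S : Finset ℝ} {s t : ℝ} (hs : s ∈ gapAround S t) :
    t ∉ S :=
  fun h => hs t h Set.right_mem_uIcc

theorem mem_gapAround_of_mem_uIcc {S : Finset ℝ} {s₁ s₂ x t : ℝ} (h₁ : s₁ ∈ gapAround S t)
    (h₂ : s₂ ∈ gapAround S t) (hx : x ∈ Set.uIcc s₁ s₂) : x ∈ gapAround S t := by
  intro a ha hat
  have h1 := h₁ a ha
  have h2 := h₂ a ha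
  simp only [Set.mem_uIcc] at *
  grind

theorem eval_pos_of_mem_gapAround {S : Finset ℝ} {D : ℝ[X]} (hD : ∀ s, D.eval s = 0 → s ∈ S)
    {s₁ s₂ t : ℝ} (h₁ : s₁ ∈ gapAround S t) (h₂ : s₂ ∈ gapAround S t) (hpos : 0 < D.eval s₁) :
    0 < D.eval s₂ := by
  by_contra hneg
  obtain ⟨x, hx, hx0⟩ := intermediate_value_uIcc (a := s₂) (b := s₁) D.continuous.continuousOn
    (show (0 : ℝ) ∈ Set.uIcc (D.eval s₂) (D.eval s₁) from
      Set.mem_uIcc.2 (Or.inl ⟨not_lt.1 hneg, hpos.le⟩))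
  exact notMem_of_mem_gapAround (mem_gapAround_of_mem_uIcc h₂ h₁ hx) (hD x hx0)

theorem sign_eval_eq_of_mem_gapAround {S : Finset ℝ} {D : ℝ[X]}
    (hD : D ≠ 0 → ∀ s, D.eval s = 0 → s ∈ S)
    {s₁ s₂ t : ℝ} (h₁ : s₁ ∈ gapAround S t) (h₂ : s₂ ∈ gapAround S t) :
    SignType.sign (D.eval s₁) = SignType.sign (D.eval s₂) := by
  by_cases h0 : D = 0
  · simp [h0]
  replace hD := hD h0
  rcases lt_trichotomy (D.eval s₁) 0 with h | h | h
  · have := eval_pos_of_mem_gapAround (D := -D) (by simpa using hD) h₁ h₂ (by simpa using h)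
    rw [eval_neg, Left.neg_pos_iff] at this
    rw [sign_neg h, sign_neg this]
  · exact absurd (hD _ h) (notMem_of_mem_gapAround h₁)
  · rw [sign_pos h, sign_pos (eval_pos_of_mem_gapAround hD h₁ h₂ h)]

/-- Rolle's theorem: two points of a gap with equal values would enclose a zero of the derivative.
In particular, a gap contains at most one root of `F`. -/
theorem eq_of_isRoot_of_mem_gapAround {S : Finset ℝ} {F : ℝ[X]}
    (hD : ∀ s, F.derivative.eval s = 0 → s ∈ S) {s₁ s₂ t : ℝ} (h₁ : s₁ ∈ gapAround S t)
    (h₂ : s₂ ∈ gapAround S t) (hF : F.eval s₁ = F.eval s₂) : s₁ = s₂ := by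
  wlog hlt : s₁ < s₂ generalizing s₁ s₂
  · rcases lt_trichotomy s₁ s₂ with h | h | h
    · exact absurd h hlt
    · exact h
    · exact (this h₂ h₁ hF.symm h).symm
  obtain ⟨c, hc, hc0⟩ := exists_deriv_eq_zero (f := fun x => F.eval x) hlt
    F.continuous.continuousOn hF
  rw [Polynomial.deriv] at hc0
  exact absurd (hD c hc0) (notMem_of_mem_gapAround
    (mem_gapAround_of_mem_uIcc h₁ h₂ (Set.Ioo_subset_Icc_self.trans Set.Icc_subset_uIcc hc)))

theorem eval_lt_eval_of_derivative_pos {F : ℝ[X]} {x y : ℝ} (hxy : x < y)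
    (hD : ∀ s ∈ Set.Ioo x y, 0 < F.derivative.eval s) : F.eval x < F.eval y := by
  refine strictMonoOn_of_deriv_pos (f := fun x => F.eval x) (convex_Icc x y)
    F.continuous.continuousOn (fun s hs => ?_) (Set.left_mem_Icc.2 hxy.le)
    (Set.right_mem_Icc.2 hxy.le) hxy
  rw [interior_Icc] at hs
  rw [Polynomial.deriv]
  exact hD s hs

theorem eval_lt_eval_of_mem_gapAround {S : Finset ℝ} {F : ℝ[X]} {t : ℝ}
    (hD : ∀ s ∈ gapAround S t, 0 < F.derivative.eval s) {x y : ℝ} (hx : x ∈ gapAround S t)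
    (hy : y ∈ gapAround S t) (hxy : x < y) : F.eval x < F.eval y :=
  eval_lt_eval_of_derivative_pos hxy fun s hs => hD s
    (mem_gapAround_of_mem_uIcc hx hy (Set.Ioo_subset_Icc_self.trans Set.Icc_subset_uIcc hs))

theorem degree_pos_of_derivative_eval_ne_zero {F : ℝ[X]} {t : ℝ}
    (h : F.derivative.eval t ≠ 0) : 0 < F.degree := by
  by_contra h0
  rw [eq_C_of_degree_le_zero (not_lt.1 h0)] at h
  simp at h

/-- The value of `F` at the left end of a gap on which it increases. -/
def NegAtLeft (F : ℝ[X]) (S : Finset ℝ) (t : ℝ) : Prop :=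
  ∀ a ∈ S, a < t → (∀ b ∈ S, b < t → b ≤ a) → F.eval a < 0

/-- The value of `F` at the right end of a gap on which it increases. -/
def PosAtRight (F : ℝ[X]) (S : Finset ℝ) (t : ℝ) : Prop :=
  ∀ a ∈ S, t < a → (∀ b ∈ S, t < b → a ≤ b) → 0 < F.eval a

theorem negAtLeft_of_eval_nonpos {S : Finset ℝ} {F : ℝ[X]} {s t : ℝ}
    (hD : ∀ s ∈ gapAround S t, 0 < F.derivative.eval s) (hs : s ∈ gapAround S t)
    (hF : F.eval s ≤ 0) : NegAtLeft F S t := by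
  intro a ha hat hmax
  have hsa := hs a ha
  have hts := notMem_center_of_mem_gapAround hs
  have has : a < s := by
    simp only [Set.mem_uIcc] at hsa
    grind
  refine (eval_lt_eval_of_derivative_pos has fun w hw => hD w fun b hb hbw => ?_).trans_le hF
  have hsb := hs b hb
  have := hmax b hb
  have hbt : b ≠ t := fun h => hts (h ▸ hb)
  simp only [Set.mem_uIcc, Set.mem_Ioo] at *
  grind

theorem posAtRight_of_eval_nonneg {S : Finset ℝ} {F : ℝ[X]} {s t : ℝ}
    (hD : ∀ s ∈ gapAround S t, 0 < F.derivative.eval s) (hs : s ∈ gapAround S t)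
    (hF : 0 ≤ F.eval s) : PosAtRight F S t := by
  intro a ha hat hmin
  have hsa := hs a ha
  have hts := notMem_center_of_mem_gapAround hs
  have has : s < a := by
    simp only [Set.mem_uIcc] at hsa
    grind
  refine hF.trans_lt (eval_lt_eval_of_derivative_pos has fun w hw => hD w fun b hb hbw => ?_)
  have hsb := hs b hb
  have := hmin b hb
  have hbt : b ≠ t := fun h => hts (h ▸ hb)
  simp only [Set.mem_uIcc, Set.mem_Ioo] at *
  grind

/-- If the gap has a left end, continuity there suffices. If it is unbounded to the left, the
hypothesis `NegAtLeft` is vacuous; but `F` is nonconstant, so `|F|` tends to infinity, and `F` is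
bounded above by `F.eval t` to the left of `t`, so it becomes negative. -/
theorem NegAtLeft.exists_eval_neg {S : Finset ℝ} {F : ℝ[X]} {t : ℝ} (ht : t ∉ S)
    (hD : ∀ s ∈ gapAround S t, 0 < F.derivative.eval s) (h : NegAtLeft F S t) :
    ∃ s ∈ gapAround S t, F.eval s < 0 := by
  by_cases hne : (S.filter (· < t)).Nonempty
  · have ha := (S.filter (· < t)).max'_mem hne
    have hmax : ∀ b ∈ S, b < t → b ≤ (S.filter (· < t)).max' hne := fun b hb hbt =>
      Finset.le_max' _ _ (Finset.mem_filter.2 ⟨hb, hbt⟩)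
    set a := (S.filter (· < t)).max' hne
    rw [Finset.mem_filter] at ha
    have hFa := h a ha.1 ha.2 hmax
    have hev : ∀ᶠ s in nhdsWithin a (Set.Ioi a), F.eval s < 0 ∧ s ∈ Set.Ioo a t :=
      Filter.Eventually.and
        (nhdsWithin_le_nhds (F.continuous.continuousAt.eventually_lt continuousAt_const hFa))
        (Ioo_mem_nhdsGT ha.2)
    obtain ⟨s, hs, hst⟩ := hev.exists
    refine ⟨s, fun b hb hbs => ?_, hs⟩
    have := hmax b hb
    have hbt : b ≠ t := fun h => ht (h ▸ hb)
    simp only [Set.mem_uIcc, Set.mem_Ioo] at *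
    grind
  · have hgap : ∀ s ≤ t, s ∈ gapAround S t := by
      intro s hst b hb hbs
      rw [Set.uIcc_of_le hst] at hbs
      exact hne ⟨b, Finset.mem_filter.2 ⟨hb, lt_of_le_of_ne hbs.2 fun h => ht (h ▸ hb)⟩⟩
    have hlim := F.tendsto_norm_atTop (l := Filter.atBot) (z := id)
      (degree_pos_of_derivative_eval_ne_zero (hD t (hgap t le_rfl)).ne')
      (Filter.tendsto_abs_atBot_atTop)
    obtain ⟨s, hs, hst⟩ := ((hlim.eventually_gt_atTop |F.eval t|).and
      (Filter.eventually_lt_atBot t)).exists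
    have hlt := eval_lt_eval_of_mem_gapAround hD (hgap s hst.le) (hgap t le_rfl) hst
    refine ⟨s, hgap s hst.le, ?_⟩
    by_contra hneg
    rw [Real.norm_eq_abs, id, abs_of_nonneg (not_lt.1 hneg)] at hs
    linarith [le_abs_self (F.eval t)]

theorem PosAtRight.exists_eval_pos {S : Finset ℝ} {F : ℝ[X]} {t : ℝ} (ht : t ∉ S)
    (hD : ∀ s ∈ gapAround S t, 0 < F.derivative.eval s) (h : PosAtRight F S t) :
    ∃ s ∈ gapAround S t, 0 < F.eval s := by
  by_cases hne : (S.filter (t < ·)).Nonempty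
  · have ha := (S.filter (t < ·)).min'_mem hne
    have hmin : ∀ b ∈ S, t < b → (S.filter (t < ·)).min' hne ≤ b := fun b hb hbt =>
      Finset.min'_le _ _ (Finset.mem_filter.2 ⟨hb, hbt⟩)
    set a := (S.filter (t < ·)).min' hne
    rw [Finset.mem_filter] at ha
    have hFa := h a ha.1 ha.2 hmin
    have hev : ∀ᶠ s in nhdsWithin a (Set.Iio a), 0 < F.eval s ∧ s ∈ Set.Ioo t a :=
      Filter.Eventually.and
        (nhdsWithin_le_nhds (continuousAt_const.eventually_lt F.continuous.continuousAt hFa))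
        (Ioo_mem_nhdsLT ha.2)
    obtain ⟨s, hs, hst⟩ := hev.exists
    refine ⟨s, fun b hb hbs => ?_, hs⟩
    have := hmin b hb
    have hbt : b ≠ t := fun h => ht (h ▸ hb)
    simp only [Set.mem_uIcc, Set.mem_Ioo] at *
    grind
  · have hgap : ∀ s, t ≤ s → s ∈ gapAround S t := by
      intro s hst b hb hbs
      rw [Set.uIcc_of_ge hst] at hbs
      exact hne ⟨b, Finset.mem_filter.2 ⟨hb, lt_of_le_of_ne hbs.1 fun h => ht (h ▸ hb)⟩⟩
    have hlim := F.tendsto_norm_atTop (l := Filter.atTop) (z := id)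
      (degree_pos_of_derivative_eval_ne_zero (hD t (hgap t le_rfl)).ne')
      (Filter.tendsto_abs_atTop_atTop)
    obtain ⟨s, hs, hst⟩ := ((hlim.eventually_gt_atTop |F.eval t|).and
      (Filter.eventually_gt_atTop t)).exists
    have hlt := eval_lt_eval_of_mem_gapAround hD (hgap t le_rfl) (hgap s hst.le) hst
    refine ⟨s, hgap s hst.le, ?_⟩
    by_contra hneg
    rw [Real.norm_eq_abs, id, abs_of_nonpos (not_lt.1 hneg)] at hs
    linarith [neg_abs_le (F.eval t)]

/-- `φ` matches the points of `S` with those of `S'`, and the signs of `F` there with those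
of `F'`. -/
structure MatchesOn (φ : ℝ ≃o ℝ) (S S' : Finset ℝ) (F F' : ℝ[X]) : Prop where
  mem_iff : ∀ a, a ∈ S ↔ φ a ∈ S'
  sign_eq : ∀ a ∈ S, SignType.sign (F.eval a) = SignType.sign (F'.eval (φ a))

namespace MatchesOn

variable {φ : ℝ ≃o ℝ} {S S' : Finset ℝ} {F F' : ℝ[X]} {t : ℝ}

theorem symm (h : MatchesOn φ S S' F F') : MatchesOn φ.symm S' S F' F where
  mem_iff a := by rw [h.mem_iff, φ.apply_symm_apply]
  sign_eq a ha := by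
    rw [h.sign_eq, φ.apply_symm_apply]
    rwa [h.mem_iff, φ.apply_symm_apply]

theorem neg (h : MatchesOn φ S S' F F') : MatchesOn φ S S' (-F) (-F') where
  mem_iff := h.mem_iff
  sign_eq a ha := by
    rw [eval_neg, eval_neg, Left.sign_neg, Left.sign_neg, h.sign_eq a ha]

theorem mem_gapAround_iff (h : MatchesOn φ S S' F F') {s : ℝ} :
    s ∈ gapAround S t ↔ φ s ∈ gapAround S' (φ t) := by
  constructor
  · intro hs a ha hat
    refine hs (φ.symm a) (by rwa [h.mem_iff, φ.apply_symm_apply]) ?_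
    rw [Set.mem_uIcc] at hat ⊢
    simpa only [φ.le_symm_apply, φ.symm_apply_le] using hat
  · intro hs a ha hat
    refine hs (φ a) ((h.mem_iff a).1 ha) ?_
    rw [Set.mem_uIcc] at hat ⊢
    simpa only [φ.le_iff_le] using hat

theorem negAtLeft (h : MatchesOn φ S S' F F') (hF : NegAtLeft F S t) :
    NegAtLeft F' S' (φ t) := by
  intro a ha hat hmax
  have haS : φ.symm a ∈ S := by rwa [h.mem_iff, φ.apply_symm_apply]
  have := hF (φ.symm a) haS (φ.symm_apply_lt.2 hat) fun b hb hbt => by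
    rw [φ.le_symm_apply]
    exact hmax _ ((h.mem_iff b).1 hb) (φ.lt_iff_lt.2 hbt)
  rw [← sign_eq_neg_one_iff, h.sign_eq _ haS, φ.apply_symm_apply, sign_eq_neg_one_iff] at this
  exact this

theorem posAtRight (h : MatchesOn φ S S' F F') (hF : PosAtRight F S t) :
    PosAtRight F' S' (φ t) := by
  intro a ha hat hmin
  have haS : φ.symm a ∈ S := by rwa [h.mem_iff, φ.apply_symm_apply]
  have := hF (φ.symm a) haS (φ.lt_symm_apply.2 hat) fun b hb hbt => by
    rw [φ.symm_apply_le]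
    exact hmin _ ((h.mem_iff b).1 hb) (φ.lt_iff_lt.2 hbt)
  rw [← sign_eq_one_iff, h.sign_eq _ haS, φ.apply_symm_apply, sign_eq_one_iff] at this
  exact this

/-- A root of an increasing `F` in a gap forces a negative value at a finite left end and a positive
value at a finite right end. These end conditions are carried over by `φ`, and the intermediate
value theorem gives a root of `F'`. Here `F'` is the second polynomial, not a derivative. -/
theorem exists_isRoot_of_pos (h : MatchesOn φ S S' F F') (ht : t ∉ S)
    (hD : ∀ s ∈ gapAround S t, 0 < F.derivative.eval s)
    (hD' : ∀ s ∈ gapAround S' (φ t), 0 < F'.derivative.eval s) (h0 : F.eval t = 0) :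
    ∃ r ∈ gapAround S' (φ t), F'.eval r = 0 := by
  have ht' : φ t ∉ S' := fun h' => ht ((h.mem_iff t).2 h')
  obtain ⟨x, hx, hx0⟩ := (h.negAtLeft (negAtLeft_of_eval_nonpos hD
    (self_mem_gapAround ht) h0.le)).exists_eval_neg ht' hD'
  obtain ⟨y, hy, hy0⟩ := (h.posAtRight (posAtRight_of_eval_nonneg hD
    (self_mem_gapAround ht) h0.ge)).exists_eval_pos ht' hD'
  obtain ⟨r, hr, hr0⟩ := intermediate_value_uIcc (a := x) (b := y) F'.continuous.continuousOn
    (Set.mem_uIcc.2 (Or.inl ⟨hx0.le, hy0.le⟩))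
  exact ⟨r, mem_gapAround_of_mem_uIcc hx hy hr, hr0⟩

/-- Suppose `F` is negative at `t` but `F'` is not negative at `φ t`. Then `F'`, hence `F`,
satisfies the condition at the right end, so `F` has a root `r > t` in the gap. Now `F'` vanishes at
`φ r > φ t`, which contradicts its monotonicity. The positive case is symmetric. -/
theorem sign_eval_eq_of_pos (h : MatchesOn φ S S' F F') (ht : t ∉ S)
    (hD : ∀ s ∈ gapAround S t, 0 < F.derivative.eval s)
    (hD' : ∀ s ∈ gapAround S' (φ t), 0 < F'.derivative.eval s)
    (hr : ∀ r ∈ gapAround S t, F.eval r = 0 → F'.eval (φ r) = 0) :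
    SignType.sign (F.eval t) = SignType.sign (F'.eval (φ t)) := by
  have ht' : φ t ∉ S' := fun h' => ht ((h.mem_iff t).2 h')
  have hφ : φ.symm (φ t) = t := φ.symm_apply_apply t
  rcases lt_trichotomy (F.eval t) 0 with hlt | h0 | hgt
  · rw [sign_neg hlt, eq_comm, sign_eq_neg_one_iff]
    by_contra hcon
    have hpos := h.symm.posAtRight (posAtRight_of_eval_nonneg hD' (self_mem_gapAround ht')
      (not_lt.1 hcon))
    rw [hφ] at hpos
    obtain ⟨s, hs, hs0⟩ := hpos.exists_eval_pos ht hD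
    obtain ⟨r, hr1, hr0⟩ := intermediate_value_uIcc (a := t) (b := s) F.continuous.continuousOn
      (Set.mem_uIcc.2 (Or.inl ⟨hlt.le, hs0.le⟩))
    have hrg := mem_gapAround_of_mem_uIcc (self_mem_gapAround ht) hs hr1
    have htr : t < r := by
      rcases lt_trichotomy t r with h' | h' | h'
      · exact h'
      · exact absurd (h' ▸ hr0) hlt.ne
      · have := eval_lt_eval_of_mem_gapAround hD hrg (self_mem_gapAround ht) h'
        linarith
    have := eval_lt_eval_of_mem_gapAround hD' (self_mem_gapAround ht')
      (h.mem_gapAround_iff.1 hrg) (φ.lt_iff_lt.2 htr)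
    rw [hr r hrg hr0] at this
    exact hcon this
  · rw [h0, hr t (self_mem_gapAround ht) h0]
  · rw [sign_pos hgt, eq_comm, sign_eq_one_iff]
    by_contra hcon
    have hneg := h.symm.negAtLeft (negAtLeft_of_eval_nonpos hD' (self_mem_gapAround ht')
      (not_lt.1 hcon))
    rw [hφ] at hneg
    obtain ⟨s, hs, hs0⟩ := hneg.exists_eval_neg ht hD
    obtain ⟨r, hr1, hr0⟩ := intermediate_value_uIcc (a := s) (b := t) F.continuous.continuousOn
      (Set.mem_uIcc.2 (Or.inl ⟨hs0.le, hgt.le⟩))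
    have hrg := mem_gapAround_of_mem_uIcc hs (self_mem_gapAround ht) hr1
    have htr : r < t := by
      rcases lt_trichotomy t r with h' | h' | h'
      · have := eval_lt_eval_of_mem_gapAround hD (self_mem_gapAround ht) hrg h'
        linarith
      · exact absurd (h' ▸ hr0) hgt.ne'
      · exact h'
    have := eval_lt_eval_of_mem_gapAround hD' (h.mem_gapAround_iff.1 hrg)
      (self_mem_gapAround ht') (φ.lt_iff_lt.2 htr)
    rw [hr r hrg hr0] at this
    exact hcon this

theorem exists_isRoot (h : MatchesOn φ S S' F F') (ht : t ∉ S)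
    (hS : ∀ s, F.derivative.eval s = 0 → s ∈ S) (hS' : ∀ s, F'.derivative.eval s = 0 → s ∈ S')
    (hD : SignType.sign (F.derivative.eval t) = SignType.sign (F'.derivative.eval (φ t)))
    (h0 : F.eval t = 0) : ∃ r ∈ gapAround S' (φ t), F'.eval r = 0 := by
  have htg := self_mem_gapAround ht
  have htg' := h.mem_gapAround_iff.1 htg
  rcases lt_trichotomy (F.derivative.eval t) 0 with hlt | heq | hgt
  · have hlt' : F'.derivative.eval (φ t) < 0 := by
      rwa [sign_neg hlt, eq_comm, sign_eq_neg_one_iff] at hD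
    obtain ⟨r, hr, hr0⟩ := h.neg.exists_isRoot_of_pos ht
      (fun s hs => eval_pos_of_mem_gapAround (by simpa using hS) htg hs (by simpa using hlt))
      (fun s hs => eval_pos_of_mem_gapAround (by simpa using hS') htg' hs (by simpa using hlt'))
      (by simpa using h0)
    exact ⟨r, hr, by simpa using hr0⟩
  · exact absurd (hS t heq) ht
  · have hgt' : 0 < F'.derivative.eval (φ t) := by
      rwa [sign_pos hgt, eq_comm, sign_eq_one_iff] at hD
    exact h.exists_isRoot_of_pos ht (fun s hs => eval_pos_of_mem_gapAround hS htg hs hgt)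
      (fun s hs => eval_pos_of_mem_gapAround hS' htg' hs hgt') h0

/-- The derivatives have constant equal signs on corresponding gaps; a negative sign is reduced to a
positive one by negating both polynomials. -/
theorem sign_eval_eq (h : MatchesOn φ S S' F F') (ht : t ∉ S)
    (hS : ∀ s, F.derivative.eval s = 0 → s ∈ S) (hS' : ∀ s, F'.derivative.eval s = 0 → s ∈ S')
    (hD : SignType.sign (F.derivative.eval t) = SignType.sign (F'.derivative.eval (φ t)))
    (hr : ∀ r, r ∉ S → F.eval r = 0 → F'.eval (φ r) = 0) :
    SignType.sign (F.eval t) = SignType.sign (F'.eval (φ t)) := by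
  have htg := self_mem_gapAround ht
  have htg' := h.mem_gapAround_iff.1 htg
  rcases lt_trichotomy (F.derivative.eval t) 0 with hlt | heq | hgt
  · have hlt' : F'.derivative.eval (φ t) < 0 := by
      rwa [sign_neg hlt, eq_comm, sign_eq_neg_one_iff] at hD
    have := h.neg.sign_eval_eq_of_pos ht
      (fun s hs => eval_pos_of_mem_gapAround (by simpa using hS) htg hs (by simpa using hlt))
      (fun s hs => eval_pos_of_mem_gapAround (by simpa using hS') htg' hs (by simpa using hlt'))
      (fun r hrg hr0 => by simpa using hr r (notMem_of_mem_gapAround hrg) (by simpa using hr0))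
    rwa [eval_neg, eval_neg, Left.sign_neg, Left.sign_neg, neg_inj] at this
  · exact absurd (hS t heq) ht
  · have hgt' : 0 < F'.derivative.eval (φ t) := by
      rwa [sign_pos hgt, eq_comm, sign_eq_one_iff] at hD
    exact h.sign_eval_eq_of_pos ht (fun s hs => eval_pos_of_mem_gapAround hS htg hs hgt)
      (fun s hs => eval_pos_of_mem_gapAround hS' htg' hs hgt')
      (fun r hrg hr0 => hr r (notMem_of_mem_gapAround hrg) hr0)

end MatchesOn

/-- A gap of a finite set contains an open neighbourhood of each of its compact intervals. -/
theorem exists_Ioo_subset_gapAround {S : Finset ℝ} {u v : ℝ} (hv : v ∈ gapAround S u) :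
    ∃ c d, u ∈ Set.Ioo c d ∧ v ∈ Set.Ioo c d ∧ Set.Ioo c d ⊆ gapAround S u := by
  have hopen : IsOpen ((S : Set ℝ)ᶜ) := S.finite_toSet.isClosed.isOpen_compl
  have key : ∀ x ∈ Set.uIcc u v, ∃ ε > 0, Metric.ball x ε ⊆ (S : Set ℝ)ᶜ := by
    intro x hx
    exact Metric.isOpen_iff.1 hopen x fun hxS => hv x hxS (Set.uIcc_comm u v ▸ hx)
  obtain ⟨ε₁, h1, hb1⟩ := key (min u v) ⟨le_rfl, min_le_max⟩
  obtain ⟨ε₂, h2, hb2⟩ := key (max u v) ⟨min_le_max, le_rfl⟩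
  refine ⟨min u v - ε₁, max u v + ε₂, ⟨?_, ?_⟩, ⟨?_, ?_⟩, ?_⟩
  · linarith [min_le_left u v]
  · linarith [le_max_left u v]
  · linarith [min_le_right u v]
  · linarith [le_max_right u v]
  · intro x hx a ha hax
    have h3 := hv a ha
    have h4 : ¬ |a - min u v| < ε₁ := fun h => hb1 (by simpa [Real.dist_eq] using h) ha
    have h5 : ¬ |a - max u v| < ε₂ := fun h => hb2 (by simpa [Real.dist_eq] using h) ha
    rw [Set.mem_uIcc] at h3 hax
    rw [Set.mem_Ioo] at hx
    rw [abs_lt] at h4 h5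
    grind

end Refinement

/-! ### Univariate polynomials with parameters: sign patterns up to monotone change of variable -/

section

open Polynomial

/-- An order isomorphism matching the signs of a finite family containing the derivative of `F` and
matching the sign of `F` at the zeros of that family can be modified so that it matches the signs
of `F` as well. -/
theorem exists_orderIso_sign_eval_eq {α : Type*} [Finite α] {g g' : α → ℝ[X]} {F F' : ℝ[X]}
    {φ : ℝ ≃o ℝ}
    (hφ : ∀ i t, SignType.sign ((g i).eval t) = SignType.sign ((g' i).eval (φ t)))
    {i₀ : α} (hD : g i₀ = F.derivative) (hD' : g' i₀ = F'.derivative)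
    (h0 : SignType.sign (F.coeff 0) = SignType.sign (F'.coeff 0))
    (hroot : ∀ i, g i ≠ 0 → ∀ t, (g i).eval t = 0 →
      SignType.sign (F.eval t) = SignType.sign (F'.eval (φ t))) :
    ∃ ψ : ℝ ≃o ℝ,
      (∀ i t, SignType.sign ((g i).eval t) = SignType.sign ((g' i).eval (ψ t))) ∧
      ∀ t, SignType.sign (F.eval t) = SignType.sign (F'.eval (ψ t)) := by
  classical
  cases nonempty_fintype α
  have hzero : ∀ i, g i = 0 ↔ g' i = 0 := by
    intro i
    constructor
    · intro h
      refine Polynomial.funext fun t => ?_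
      have := hφ i (φ.symm t)
      rw [h, eval_zero, sign_zero, φ.apply_symm_apply, eq_comm, sign_eq_zero_iff] at this
      rw [this, eval_zero]
    · intro h
      refine Polynomial.funext fun t => ?_
      have := hφ i t
      rw [h, eval_zero, sign_zero, sign_eq_zero_iff] at this
      rw [this, eval_zero]
  -- Constant polynomials are settled by `h0`; otherwise the roots of the derivatives belong to `S`
  -- and `S'`.
  by_cases hF : F.derivative = 0
  · have hF' : F'.derivative = 0 := by rwa [← hD', ← hzero, hD]
    refine ⟨φ, hφ, fun t => ?_⟩
    rw [eq_C_of_natDegree_eq_zero (derivative_eq_zero.1 hF),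
      eq_C_of_natDegree_eq_zero (derivative_eq_zero.1 hF'), eval_C, eval_C, h0]
  have hF' : F'.derivative ≠ 0 := by rwa [← hD', Ne, ← hzero, hD]
  set S : Finset ℝ := Finset.univ.biUnion fun i => (g i).roots.toFinset with hS
  set S' : Finset ℝ := Finset.univ.biUnion fun i => (g' i).roots.toFinset with hS'
  have memS : ∀ t, t ∈ S ↔ ∃ i, g i ≠ 0 ∧ (g i).eval t = 0 := by
    intro t; simp [hS, mem_roots']
  have memS' : ∀ t, t ∈ S' ↔ ∃ i, g' i ≠ 0 ∧ (g' i).eval t = 0 := by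
    intro t; simp [hS', mem_roots']
  have hDS : ∀ s, F.derivative.eval s = 0 → s ∈ S := fun s hs =>
    (memS s).2 ⟨i₀, by rwa [hD], by rwa [hD]⟩
  have hDS' : ∀ s, F'.derivative.eval s = 0 → s ∈ S' := fun s hs =>
    (memS' s).2 ⟨i₀, by rwa [hD'], by rwa [hD']⟩
  have hmatch : ∀ χ : ℝ ≃o ℝ,
      (∀ i t, SignType.sign ((g i).eval t) = SignType.sign ((g' i).eval (χ t))) →
      ∀ a, a ∈ S ↔ χ a ∈ S' := by
    intro χ hχ a
    rw [memS, memS']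
    refine exists_congr fun i => ?_
    rw [Ne, Ne, hzero, ← sign_eq_zero_iff (a := (g i).eval a), hχ, sign_eq_zero_iff]
  -- Adjust the isomorphism at the roots of `F` outside `S` one at a time, sending each to a root of
  -- `F'`.
  have key : ∀ T : Finset ℝ, (∀ r ∈ T, r ∉ S ∧ F.eval r = 0) → ∃ ψ : ℝ ≃o ℝ,
      (∀ i t, SignType.sign ((g i).eval t) = SignType.sign ((g' i).eval (ψ t))) ∧
      (∀ a ∈ S, SignType.sign (F.eval a) = SignType.sign (F'.eval (ψ a))) ∧
      ∀ r ∈ T, F'.eval (ψ r) = 0 := by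
    intro T
    induction T using Finset.induction_on with
    | empty =>
      refine fun _ => ⟨φ, hφ, fun a ha => ?_, by simp⟩
      obtain ⟨i, hi, hia⟩ := (memS a).1 ha
      exact hroot i hi a hia
    | insert r T hrT ih =>
      intro hT
      obtain ⟨χ, hχ, hχS, hχT⟩ := ih fun r hr => hT r (Finset.mem_insert_of_mem hr)
      by_cases hr0 : F'.eval (χ r) = 0
      · exact ⟨χ, hχ, hχS, fun x hx => (Finset.mem_insert.1 hx).elim
          (fun h => h ▸ hr0) (hχT x)⟩
      obtain ⟨hrS, hFr⟩ := hT r (Finset.mem_insert_self _ _)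
      have hM : MatchesOn χ S S' F F' := ⟨hmatch χ hχ, hχS⟩
      -- `v` is a root of `F'` in the same gap of `S'` as `χ r`. Composing with a bijection `θ` that
      -- moves `χ r` to `v` and is supported in that gap leaves the signs of the `g' i` and the
      -- values at points of `S'` unchanged.
      obtain ⟨v, hv, hFv⟩ := hM.exists_isRoot hrS hDS hDS' (by rw [← hD, ← hD', hχ]) hFr
      obtain ⟨c, d, hu, hvI, hI⟩ := exists_Ioo_subset_gapAround hv
      obtain ⟨θ, hθ, hθout⟩ := exists_orderIso_apply_eq hu hvI
      have hθin : ∀ t ∈ Set.Ioo c d, θ t ∈ Set.Ioo c d := by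
        intro t ht
        rw [← hθout c (by simp), ← hθout d (by simp)]
        exact ⟨θ.lt_iff_lt.2 ht.1, θ.lt_iff_lt.2 ht.2⟩
      refine ⟨χ.trans θ, fun i t => ?_, fun a ha => ?_, fun x hx => ?_⟩
      · rw [hχ i t, OrderIso.trans_apply]
        by_cases ht : χ t ∈ Set.Ioo c d
        · exact sign_eval_eq_of_mem_gapAround (fun hi s hs => (memS' s).2 ⟨i, hi, hs⟩)
            (hI ht) (hI (hθin _ ht))
        · rw [hθout _ ht]
      · rw [hχS a ha, OrderIso.trans_apply, hθout]
        exact fun h => notMem_of_mem_gapAround (hI h) ((hM.mem_iff a).1 ha)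
      · rw [OrderIso.trans_apply]
        rcases Finset.mem_insert.1 hx with rfl | hxT
        · rw [hθ, hFv]
        · rw [hθout, hχT x hxT]
          -- An earlier root moved by `θ` would share a gap with `r`, hence equal `r` by Rolle's
          -- theorem.
          intro h
          have hxg := hM.mem_gapAround_iff.2 (hI h)
          have hxr := eq_of_isRoot_of_mem_gapAround hDS hxg (self_mem_gapAround hrS)
            ((hT x hx).2.trans hFr.symm)
          exact hrT (hxr ▸ hxT)
  have hF0 : F ≠ 0 := by
    rintro rfl
    simp at hF
  obtain ⟨ψ, hψ, hψS, hψT⟩ := key (F.roots.toFinset \ S) fun r hr => by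
    rw [Finset.mem_sdiff, Multiset.mem_toFinset, mem_roots'] at hr
    exact ⟨hr.2, hr.1.2⟩
  have hM : MatchesOn ψ S S' F F' := ⟨hmatch ψ hψ, hψS⟩
  refine ⟨ψ, hψ, fun t => ?_⟩
  by_cases ht : t ∈ S
  · exact hψS t ht
  · refine hM.sign_eval_eq ht hDS hDS' (by rw [← hD, ← hD', hψ]) fun r hr hr0 => hψT r ?_
    rw [Finset.mem_sdiff, Multiset.mem_toFinset, mem_roots']
    exact ⟨⟨hF0, hr0⟩, hr⟩

/-- The signs of finitely many elements of `R` at a real point of `R` determine, up to a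
monotone change of variable, the signs of the given finitely many polynomials over `R`. -/
theorem exists_finset_forall_exists_orderIso {R : Type*} [CommRing R] (P : Finset R[X]) :
    ∃ C : Finset R, ∀ x y : R →+* ℝ,
      (∀ c ∈ C, SignType.sign (x c) = SignType.sign (y c)) →
      ∃ φ : ℝ ≃o ℝ, ∀ f ∈ P, ∀ t,
        SignType.sign ((f.map x).eval t) = SignType.sign ((f.map y).eval (φ t)) := by
  classical
  suffices H : ∀ N : ℕ, ∀ P : Finset R[X], (∀ f ∈ P, f.natDegree ≤ N) →
      ∃ C : Finset R, ∀ x y : R →+* ℝ,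
      (∀ c ∈ C, SignType.sign (x c) = SignType.sign (y c)) →
      ∃ φ : ℝ ≃o ℝ, ∀ f ∈ P, ∀ t,
        SignType.sign ((f.map x).eval t) = SignType.sign ((f.map y).eval (φ t)) from
    H (P.sup natDegree) P fun f hf => Finset.le_sup (f := natDegree) hf
  intro N
  induction N with
  | zero =>
    intro P hP
    refine ⟨P.image fun f => f.coeff 0, fun x y hxy => ⟨OrderIso.refl ℝ, fun f hf t => ?_⟩⟩
    have := hxy _ (Finset.mem_image_of_mem (fun f => f.coeff 0) hf)
    rw [eq_C_of_natDegree_le_zero (hP f hf)]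
    simpa using this
  | succ N ihN =>
    -- Inner induction on the number of polynomials that may have degree `N + 1`. The family `P` of
    -- lower degree is arbitrary, so each step may enlarge it.
    suffices H : ∀ Q : Finset R[X], (∀ f ∈ Q, f.natDegree ≤ N + 1) →
        ∀ P : Finset R[X], (∀ f ∈ P, f.natDegree ≤ N) →
        ∃ C : Finset R, ∀ x y : R →+* ℝ,
        (∀ c ∈ C, SignType.sign (x c) = SignType.sign (y c)) →
        ∃ φ : ℝ ≃o ℝ, ∀ f ∈ P ∪ Q, ∀ t,
          SignType.sign ((f.map x).eval t) = SignType.sign ((f.map y).eval (φ t)) by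
      intro P hP
      simpa using H P hP ∅ (by simp)
    intro Q
    induction Q using Finset.induction_on with
    | empty =>
      intro _ P hP
      simpa using ihN P hP
    | insert f Q hfQ ih =>
      intro hQ P hP
      choose! rem hrem_deg hrem using fun (g : R[X]) (k : ℕ) (hk : 0 < k) =>
        exists_pseudoRemainder f g hk
      set G : Finset R[X] := insert f.derivative (P ∪ Q) with hG
      have hfdeg := hQ f (Finset.mem_insert_self f Q)
      have hf' : f.derivative.natDegree ≤ N := (natDegree_derivative_le f).trans (by omega)
      have hGdeg : ∀ g ∈ G, g.natDegree ≤ N + 1 := by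
        intro g hg
        rcases Finset.mem_insert.1 hg with rfl | hg
        · omega
        rcases Finset.mem_union.1 hg with hg | hg
        · have := hP g hg; omega
        · exact hQ g (Finset.mem_insert_of_mem hg)
      -- Trade `f` for polynomials of degree at most `N`: its derivative, its constant term, its
      -- pseudo-remainders by all `g ∈ G` for every possible specialized degree, and all
      -- coefficients of the `g ∈ G`. The signs of these coefficients ensure that `g` has the same
      -- degree at both specializations, so that the same pseudo-remainder serves both.
      set P' : Finset R[X] := insert f.derivative (insert (C (f.coeff 0)) (P ∪
        ((G ×ˢ Finset.Icc 1 (N + 1)).image (fun q => rem q.1 q.2) ∪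
          (G ×ˢ Finset.range (N + 2)).image (fun q => C (q.1.coeff q.2))))) with hP'
      obtain ⟨C', hC'⟩ := ih (fun g hg => hQ g (Finset.mem_insert_of_mem hg)) P' (by
        intro g hg
        simp only [hP', Finset.mem_insert, Finset.mem_union, Finset.mem_image,
          Finset.mem_product, Finset.mem_Icc] at hg
        rcases hg with rfl | rfl | hg | ⟨⟨g, k⟩, ⟨_, hk⟩, rfl⟩ | ⟨⟨g, k⟩, _, rfl⟩
        · exact hf'
        · simp
        · exact hP g hg
        · have := hrem_deg g k hk.1
          simp only at *
          omega
        · simp)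
      refine ⟨C', fun x y hxy => ?_⟩
      obtain ⟨φ, hφ⟩ := hC' x y hxy
      have hφ' : ∀ g ∈ P', ∀ t,
          SignType.sign ((g.map x).eval t) = SignType.sign ((g.map y).eval (φ t)) :=
        fun g hg => hφ g (Finset.mem_union_left _ hg)
      have hφG : ∀ g ∈ G, ∀ t,
          SignType.sign ((g.map x).eval t) = SignType.sign ((g.map y).eval (φ t)) := by
        intro g hg
        refine hφ g ?_
        simp only [hG, hP', Finset.mem_insert, Finset.mem_union] at hg ⊢
        tauto
      have hcoeff : ∀ g ∈ G, ∀ i, SignType.sign (x (g.coeff i)) =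
          SignType.sign (y (g.coeff i)) := by
        intro g hg i
        rcases lt_or_ge i (N + 2) with hi | hi
        · have := hφ' (C (g.coeff i)) (by
            simp only [hP', Finset.mem_insert, Finset.mem_union, Finset.mem_image]
            exact Or.inr (Or.inr (Or.inr (Or.inr ⟨(g, i),
              Finset.mem_product.2 ⟨hg, Finset.mem_range.2 hi⟩, rfl⟩)))) 0
          simpa using this
        · rw [coeff_eq_zero_of_natDegree_lt (by have := hGdeg g hg; omega)]
          simp
      have hdeg : ∀ g ∈ G, (g.map x).natDegree = (g.map y).natDegree := by
        intro g hg
        have hsupp : (g.map x).support = (g.map y).support := by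
          ext i
          rw [mem_support_iff, mem_support_iff, coeff_map, coeff_map, Ne, Ne,
            ← sign_eq_zero_iff, hcoeff g hg, sign_eq_zero_iff]
        simp only [natDegree, degree, hsupp]
      obtain ⟨ψ, hψ, hψf⟩ := exists_orderIso_sign_eval_eq (α := G)
        (g := fun g => (g : R[X]).map x) (g' := fun g => (g : R[X]).map y)
        (F := f.map x) (F' := f.map y) (φ := φ) (fun g t => hφG g g.2 t)
        (i₀ := ⟨f.derivative, Finset.mem_insert_self _ _⟩) (derivative_map f x).symm
        (derivative_map f y).symm (by
          have := hφ' (C (f.coeff 0)) (by simp [hP']) 0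
          simpa using this) (by
          rintro ⟨g, hg⟩ hg0 t ht
          simp only at hg0 ht
          have hk : 0 < (g.map x).natDegree := by
            by_contra hk
            rw [eq_C_of_natDegree_eq_zero (by omega : (g.map x).natDegree = 0)] at ht hg0
            rw [eval_C] at ht
            rw [ht, C_0] at hg0
            exact hg0 rfl
          have hkN : (g.map x).natDegree ≤ N + 1 := natDegree_map_le.trans (hGdeg g hg)
          obtain ⟨c, hc, hcx⟩ := hrem g _ hk x rfl
          obtain ⟨c', hc', hcy⟩ := hrem g _ hk y (hdeg g hg).symm
          have hty : (g.map y).eval (φ t) = 0 := by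
            rw [← sign_eq_zero_iff, ← hφG g hg, ht, sign_zero]
          -- At a root of `g` the remainder is a positive multiple of `f`, so its known sign is the
          -- sign of `f`.
          have := hφ' (rem g (g.map x).natDegree) (by
            simp only [hP', Finset.mem_insert, Finset.mem_union, Finset.mem_image]
            exact Or.inr (Or.inr (Or.inr (Or.inl ⟨(g, (g.map x).natDegree),
              Finset.mem_product.2 ⟨hg, Finset.mem_Icc.2 ⟨hk, hkN⟩⟩, rfl⟩)))) t
          rw [hcx t ht, hcy _ hty, sign_mul, sign_mul, sign_pos hc, sign_pos hc', one_mul,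
            one_mul] at this
          exact this)
      refine ⟨ψ, fun g hg t => ?_⟩
      rcases Finset.mem_union.1 hg with hg | hg
      · exact hψ ⟨g, Finset.mem_insert_of_mem (Finset.mem_union_left _ hg)⟩ t
      rcases Finset.mem_insert.1 hg with rfl | hg
      · exact hψf t
      · exact hψ ⟨g, Finset.mem_insert_of_mem (Finset.mem_union_right _ hg)⟩ t

end

/-! ### Tarski–Seidenberg -/

section Projection

variable {ι : Type*}

/-- View the defining polynomials as univariate over the polynomial ring in the remaining variables.
If `t` is a witness over `x`, then `φ t` is one over `y`. -/
theorem IsSemialgebraic.exists_option {A : Set (Option ι → ℝ)} (hA : IsSemialgebraic A) :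
    IsSemialgebraic {x : ι → ℝ | ∃ t : ℝ, (fun o : Option ι => o.elim t x) ∈ A} := by
  classical
  obtain ⟨C, hC⟩ := isSemialgebraic_iff_signDetermined.1 hA
  obtain ⟨C', hC'⟩ := exists_finset_forall_exists_orderIso
    (C.image (MvPolynomial.optionEquivLeft ℝ ι))
  refine SignDetermined.isSemialgebraic (C := C') fun x y hxy => ?_
  rintro ⟨t, ht⟩
  obtain ⟨φ, hφ⟩ := hC' (MvPolynomial.eval x) (MvPolynomial.eval y) hxy
  refine ⟨φ t, hC _ _ (fun c hc => ?_) ht⟩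
  have := hφ _ (Finset.mem_image_of_mem _ hc) t
  rwa [← MvPolynomial.optionEquivLeft_elim_eval, ← MvPolynomial.optionEquivLeft_elim_eval] at this

/-- The Tarski–Seidenberg theorem: projections of semi-algebraic sets are semi-algebraic. -/
theorem IsSemialgebraic.exists_sumElim {κ : Type*} [Finite κ] {A : Set (ι ⊕ κ → ℝ)}
    (hA : IsSemialgebraic A) :
    IsSemialgebraic {x : ι → ℝ | ∃ w : κ → ℝ, Sum.elim x w ∈ A} := by
  induction κ using Finite.induction_empty_option with
  | of_equiv e ih =>
    convert ih (hA.preimage_comp (Sum.map id e.symm)) using 1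
    ext x
    constructor
    · rintro ⟨w, hw⟩
      refine ⟨w ∘ e, ?_⟩
      rw [Set.mem_ofPred_eq, Sum.elim_comp_map]
      simpa [Function.comp_assoc] using hw
    · rintro ⟨w, hw⟩
      refine ⟨w ∘ e.symm, ?_⟩
      rw [Set.mem_ofPred_eq, Sum.elim_comp_map] at hw
      simpa using hw
  | h_empty =>
    convert hA.preimage_comp (Sum.elim id PEmpty.elim : ι ⊕ PEmpty → ι) using 1
    ext x
    constructor
    · rintro ⟨w, hw⟩
      rw [Set.mem_ofPred_eq, Sum.comp_elim]
      rwa [show x ∘ PEmpty.elim = w from Subsingleton.elim _ _]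
    · intro hw
      refine ⟨PEmpty.elim, ?_⟩
      rwa [Set.mem_ofPred_eq, Sum.comp_elim,
        show x ∘ PEmpty.elim = PEmpty.elim from Subsingleton.elim _ _] at hw
  | h_option ih =>
    rename_i α _
    let e : ι ⊕ Option α → Option (ι ⊕ α) :=
      Sum.elim (fun i => some (Sum.inl i)) (fun o => o.map Sum.inr)
    have := ih (hA.preimage_comp e).exists_option
    convert this using 1
    ext x
    constructor
    · rintro ⟨w, hw⟩
      refine ⟨w ∘ some, w none, ?_⟩
      rw [Set.mem_ofPred_eq]
      convert hw using 1
      ext (i | (_ | a)) <;> rfl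
    · rintro ⟨w, t, hw⟩
      refine ⟨fun o => o.elim t w, ?_⟩
      rw [Set.mem_ofPred_eq] at hw
      convert hw using 1
      ext (i | (_ | a)) <;> rfl

end Projection

/-! ### Positive definite matrices and the derivative of the determinant -/

namespace Matrix

open scoped MatrixOrder

theorem PosSemidef.exists_eq_transpose_mul_self {N : Type*} [Fintype N] [DecidableEq N]
    {A : Matrix N N ℝ} (hA : A.PosSemidef) : ∃ G : Matrix N N ℝ, A = G.transpose * G := by
  obtain ⟨G, hG⟩ := CStarAlgebra.nonneg_iff_eq_star_mul_self.mp hA.nonneg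
  exact ⟨G, by rwa [star_eq_conjTranspose, conjTranspose_eq_transpose_of_trivial] at hG⟩

/-- Simultaneous diagonalization of a positive definite and a symmetric matrix. -/
theorem PosDef.exists_simultaneous_diagonalization {N : Type*} [Fintype N] [DecidableEq N]
    {A B : Matrix N N ℝ} (hA : A.PosDef) (hB : B.IsHermitian) :
    ∃ (G : Matrix N N ℝ) (l : N → ℝ), IsUnit G.det ∧ A = G.transpose * G ∧
      B = G.transpose * diagonal l * G := by
  obtain ⟨C, hC⟩ := hA.posSemidef.exists_eq_transpose_mul_self
  have hCdet : IsUnit C.det := by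
    have := hA.det_pos.ne'
    rw [hC, det_mul] at this
    exact (right_ne_zero_of_mul this).isUnit
  -- With `A = Cᵀ C`, an orthogonal diagonalization by `U` of this symmetric matrix gives `G = Uᵀ
  -- C`.
  have hH : ((C⁻¹).transpose * B * C⁻¹).IsHermitian := by
    have := isHermitian_conjTranspose_mul_mul C⁻¹ hB
    rwa [conjTranspose_eq_transpose_of_trivial] at this
  set U : Matrix N N ℝ := (hH.eigenvectorUnitary : Matrix N N ℝ) with hU
  have hUU : U * U.transpose = 1 := by
    have := Unitary.coe_mul_star_self hH.eigenvectorUnitary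
    rw [Unitary.coe_star] at this
    rwa [star_eq_conjTranspose, conjTranspose_eq_transpose_of_trivial] at this
  have hspec : (C⁻¹).transpose * B * C⁻¹ = U * diagonal hH.eigenvalues * U.transpose := by
    have := hH.spectral_theorem
    rw [Unitary.conjStarAlgAut_apply, star_eq_conjTranspose,
      conjTranspose_eq_transpose_of_trivial] at this
    exact this
  have hUdet : IsUnit U.det := by
    have := congrArg det hUU
    rw [det_mul, det_one] at this
    exact IsUnit.of_mul_eq_one _ this
  refine ⟨U.transpose * C, hH.eigenvalues, ?_, ?_, ?_⟩
  · rw [det_mul, det_transpose]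
    exact hUdet.mul hCdet
  · rw [transpose_mul, transpose_transpose, Matrix.mul_assoc, ← Matrix.mul_assoc U, hUU,
      Matrix.one_mul, hC]
  · have h1 : C.transpose * (C⁻¹).transpose = 1 := by
      rw [← transpose_mul, nonsing_inv_mul _ hCdet, transpose_one]
    calc B = (C.transpose * (C⁻¹).transpose) * B * (C⁻¹ * C) := by
          rw [h1, nonsing_inv_mul _ hCdet, Matrix.one_mul, Matrix.mul_one]
      _ = C.transpose * ((C⁻¹).transpose * B * C⁻¹) * C := by simp only [Matrix.mul_assoc]
      _ = C.transpose * (U * diagonal hH.eigenvalues * U.transpose) * C :=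
          congrArg (fun M => C.transpose * M * C) hspec
      _ = _ := by
          rw [transpose_mul, transpose_transpose]
          simp only [Matrix.mul_assoc]

theorem posDef_transpose_mul_diagonal_mul {N : Type*} [Fintype N] [DecidableEq N]
    {G : Matrix N N ℝ} (hG : IsUnit G.det) {l : N → ℝ} (hl : ∀ i, 0 < l i) :
    (G.transpose * diagonal l * G).PosDef := by
  have := (PosDef.diagonal hl).conjTranspose_mul_mul_same
    (mulVec_injective_of_isUnit ((isUnit_iff_isUnit_det G).2 hG))
  rwa [conjTranspose_eq_transpose_of_trivial] at this

/-- In simultaneous diagonal form the matrix is `diagonal (1 + t * l i)`, with positive entries for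
small `t`. -/
theorem PosDef.eventually_posDef_add_smul {N : Type*} [Fintype N] [DecidableEq N]
    {A B : Matrix N N ℝ} (hA : A.PosDef) (hB : B.IsHermitian) :
    ∀ᶠ t : ℝ in nhds 0, (A + t • B).PosDef := by
  obtain ⟨G, l, hG, h1, h2⟩ := hA.exists_simultaneous_diagonalization hB
  have hev : ∀ᶠ t : ℝ in nhds 0, ∀ i, 0 < 1 + t * l i := by
    rw [Filter.eventually_all]
    intro i
    have : Continuous fun t : ℝ => 1 + t * l i := by fun_prop
    exact continuousAt_const.eventually_lt this.continuousAt (by simp)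
  filter_upwards [hev] with t ht
  have := posDef_transpose_mul_diagonal_mul hG ht
  convert this using 1
  have hdiag : (diagonal fun i => 1 + t * l i) = (1 : Matrix N N ℝ) + t • diagonal l := by
    rw [← diagonal_one, ← diagonal_smul, diagonal_add]
    rfl
  rw [hdiag, h1, h2]
  simp only [Matrix.mul_add, Matrix.add_mul, Matrix.mul_smul, Matrix.smul_mul, Matrix.mul_one]

theorem hasDerivAt_det_add_smul {N : Type*} [Fintype N] [DecidableEq N]
    {A : Matrix N N ℝ} (hA : IsUnit A.det) (B : Matrix N N ℝ) :
    HasDerivAt (fun t : ℝ => (A + t • B).det) (A.det * (A⁻¹ * B).trace) 0 := by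
  -- `P` is what remains of `det (1 + X • A⁻¹B)` after its constant and linear terms are removed; it
  -- contributes only at order `t ^ 2`.
  set P := (det (1 + (Polynomial.X : Polynomial ℝ) • (A⁻¹ * B).map Polynomial.C)).divX.divX
    with hPdef
  have h1 : ∀ t : ℝ, (A + t • B).det =
      A.det * (1 + (A⁻¹ * B).trace * t + P.eval t * t ^ 2) := by
    intro t
    rw [hPdef, ← det_one_add_smul]
    rw [← det_mul, Matrix.mul_add, Matrix.mul_one, Matrix.mul_smul, ← Matrix.mul_assoc,
      mul_nonsing_inv _ hA, Matrix.one_mul]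
  simp only [h1]
  have hP := (P.hasDerivAt 0).mul (hasDerivAt_pow 2 (0 : ℝ))
  have hL := ((hasDerivAt_id (0 : ℝ)).const_mul (A⁻¹ * B).trace).const_add 1
  refine ((hL.add hP).const_mul A.det).congr_deriv ?_
  simp

theorem hasDerivAt_log_det_add_smul {N : Type*} [Fintype N] [DecidableEq N]
    {A : Matrix N N ℝ} (hA : A.det ≠ 0) (B : Matrix N N ℝ) :
    HasDerivAt (fun t : ℝ => Real.log (A + t • B).det) (A⁻¹ * B).trace 0 := by
  refine ((hasDerivAt_det_add_smul hA.isUnit B).log (by simpa using hA)).congr_deriv ?_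
  rw [zero_smul, add_zero, mul_div_cancel_left₀ _ hA]

end Matrix

/-! ### Critical points of the capacity and extremizers -/

namespace QuiverBL

open Matrix

section Capacity

variable {k m : ℕ} {d : Fin k → ℕ} {n : Fin m → ℕ} {A : Fin k → Fin m → Type u}
  [∀ i j, Fintype (A i j)] {p : Fin m → ℝ} {V : Rep d n A} {Y Y' : SinkTuple n}

theorem posSemidef_sourceMatrix (hp : ∀ j, 0 < p j) (hY : ∀ j, (Y j).PosSemidef) (i : Fin k) :
    (sourceMatrix p V Y i).PosSemidef := by
  refine posSemidef_sum _ fun j _ => (posSemidef_sum _ fun a _ => ?_).smul (hp j).le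
  have := (hY j).conjTranspose_mul_mul_same (V i j a)
  rwa [conjTranspose_eq_transpose_of_trivial] at this

theorem isHermitian_sourceMatrix (hY : ∀ j, (Y j).IsHermitian) (i : Fin k) :
    (sourceMatrix p V Y i).IsHermitian := by
  unfold IsHermitian
  rw [conjTranspose_eq_transpose_of_trivial]
  simp only [sourceMatrix, transpose_sum, transpose_smul, transpose_mul, transpose_transpose]
  refine Finset.sum_congr rfl fun j _ => congrArg _ (Finset.sum_congr rfl fun a _ => ?_)
  have := (hY j).eq
  rw [conjTranspose_eq_transpose_of_trivial] at this
  rw [this, Matrix.mul_assoc]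

theorem sourceMatrix_add_smul (t : ℝ) (H : SinkTuple n) (i : Fin k) :
    sourceMatrix p V (fun j => Y j + t • H j) i =
      sourceMatrix p V Y i + t • sourceMatrix p V H i := by
  simp only [sourceMatrix, Matrix.mul_add, Matrix.add_mul, Matrix.mul_smul, Matrix.smul_mul,
    Finset.sum_add_distrib, smul_add, Finset.smul_sum]
  congr 1
  refine Finset.sum_congr rfl fun j _ => Finset.sum_congr rfl fun a _ => smul_comm _ _ _

theorem capacityRatio_nonneg (hp : ∀ j, 0 < p j) (hY : ∀ j, (Y j).PosDef) :
    0 ≤ capacityRatio p V Y :=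
  div_nonneg (Finset.prod_nonneg fun i _ =>
      (posSemidef_sourceMatrix hp (fun j => (hY j).posSemidef) i).det_nonneg)
    (Finset.prod_nonneg fun j _ => Real.rpow_nonneg (hY j).det_pos.le _)

theorem capacity_le_capacityRatio (hp : ∀ j, 0 < p j) (hY : ∀ j, (Y j).PosDef) :
    capacity p V ≤ capacityRatio p V Y := by
  refine csInf_le ⟨0, ?_⟩ ⟨Y, hY, rfl⟩
  rintro r ⟨Z, hZ, rfl⟩
  exact capacityRatio_nonneg hp hZ

/-- The Brascamp–Lieb determinant inequality for a geometric datum, in diagonal form. -/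
theorem sum_log_le_of_geometric (hp : ∀ j, 0 < p j)
    (hsource : ∀ i, ∑ j, p j • ∑ a : A i j, (V i j a).transpose * V i j a = 1)
    (hsink : ∀ j, ∑ i, ∑ a : A i j, V i j a * (V i j a).transpose = 1)
    {y : ∀ j, Fin (n j) → ℝ} (hy : ∀ j r, 0 < y j r) {μ : ∀ i, Fin (d i) → ℝ}
    (hμ : ∀ i, sourceMatrix p V (fun j => diagonal (y j)) i = diagonal (μ i)) :
    (∀ i s, 0 < μ i s) ∧
      ∑ j, p j * ∑ r, Real.log (y j r) ≤ ∑ i, ∑ s, Real.log (μ i s) := by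
  have h1 : ∀ i s, ∑ j, ∑ a : A i j, ∑ r, p j * V i j a r s ^ 2 = 1 := by
    intro i s
    have := congrFun (congrFun (hsource i) s) s
    simpa [Matrix.sum_apply, Matrix.mul_apply, Finset.mul_sum, ← pow_two] using this
  have h2 : ∀ j r, ∑ i, ∑ a : A i j, ∑ s, V i j a r s ^ 2 = 1 := by
    intro j r
    have := congrFun (congrFun (hsink j) r) r
    simpa [Matrix.sum_apply, Matrix.mul_apply, ← pow_two] using this
  have h3 : ∀ i s, ∑ j, ∑ a : A i j, ∑ r, p j * V i j a r s ^ 2 * y j r = μ i s := by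
    intro i s
    have := congrFun (congrFun (hμ i) s) s
    rw [diagonal_apply_eq] at this
    rw [← this, sourceMatrix, Matrix.sum_apply]
    refine Finset.sum_congr rfl fun j _ => ?_
    rw [Matrix.smul_apply, Matrix.sum_apply, smul_eq_mul, Finset.mul_sum]
    refine Finset.sum_congr rfl fun a _ => ?_
    rw [Matrix.mul_apply, Finset.mul_sum]
    refine Finset.sum_congr rfl fun r _ => ?_
    rw [mul_diagonal, transpose_apply]
    ring
  -- By the diagonal entries of the source condition, `p j * V i j a r s ^ 2` are probability
  -- weights over `(j, a, r)`, and `μ i s` is the corresponding mean of the `y j r`.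
  have jensen : ∀ i s, 0 < μ i s ∧ ∑ j, ∑ a : A i j, ∑ r, p j * V i j a r s ^ 2 *
      Real.log (y j r) ≤ Real.log (μ i s) := by
    intro i s
    let w : (Σ j, A i j × Fin (n j)) → ℝ := fun x => p x.1 * V i x.1 x.2.1 x.2.2 s ^ 2
    let z : (Σ j, A i j × Fin (n j)) → ℝ := fun x => y x.1 x.2.2
    have hw : ∀ x ∈ Finset.univ, 0 ≤ w x := fun x _ => mul_nonneg (hp _).le (sq_nonneg _)
    have hw1 : ∑ x, w x = 1 := by
      rw [Fintype.sum_sigma, ← h1 i s]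
      exact Finset.sum_congr rfl fun j _ => Fintype.sum_prod_type _
    have hwz : ∑ x, w x • z x = μ i s := by
      rw [Fintype.sum_sigma, ← h3 i s]
      exact Finset.sum_congr rfl fun j _ => Fintype.sum_prod_type _
    have hz : ∀ x ∈ Finset.univ, z x ∈ Set.Ioi (0 : ℝ) := fun x _ => hy _ _
    have hpos := (convex_Ioi (0 : ℝ)).sum_mem hw hw1 hz
    have hlog := strictConcaveOn_log_Ioi.concaveOn.le_map_sum hw hw1 hz
    rw [hwz] at hpos hlog
    refine ⟨hpos, le_trans (le_of_eq ?_) hlog⟩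
    rw [Fintype.sum_sigma]
    exact Finset.sum_congr rfl fun j _ => (Fintype.sum_prod_type
      (fun q : A i j × Fin (n j) => w ⟨j, q⟩ • Real.log (z ⟨j, q⟩))).symm
  refine ⟨fun i s => (jensen i s).1, le_trans (le_of_eq ?_)
    (Finset.sum_le_sum fun i _ => Finset.sum_le_sum fun s _ => (jensen i s).2)⟩
  -- On summing over `(i, s)`, the diagonal entries of the sink condition give each `log (y j r)`
  -- total weight `p j`.
  calc ∑ j, p j * ∑ r, Real.log (y j r)
      = ∑ j, ∑ r, ∑ i, ∑ a : A i j, ∑ s, p j * V i j a r s ^ 2 * Real.log (y j r) := by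
        refine Finset.sum_congr rfl fun j _ => ?_
        rw [Finset.mul_sum]
        refine Finset.sum_congr rfl fun r _ => ?_
        simp only [← Finset.sum_mul, ← Finset.mul_sum, h2, mul_one]
    _ = ∑ j, ∑ i, ∑ s, ∑ a : A i j, ∑ r, p j * V i j a r s ^ 2 * Real.log (y j r) := by
        refine Finset.sum_congr rfl fun j _ => ?_
        rw [Finset.sum_comm]
        refine Finset.sum_congr rfl fun i _ => ?_
        rw [Finset.sum_comm]
        simp only [Finset.sum_comm (s := (Finset.univ : Finset (Fin (n j))))]
        rw [Finset.sum_comm]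
    _ = _ := by
        rw [Finset.sum_comm]
        exact Finset.sum_congr rfl fun i _ => Finset.sum_comm

theorem posDef_sourceMatrix_of_mem (hp : ∀ j, 0 < p j) (h : (V, Y) ∈ fixedPointSet d n A p)
    (i : Fin k) : (sourceMatrix p V Y i).PosDef :=
  (posSemidef_sourceMatrix hp (fun j => (h.1 j).posSemidef) i).posDef_iff_isUnit.2 (h.2.1 i)

theorem capacityRatio_pos_of_mem (hp : ∀ j, 0 < p j) (h : (V, Y) ∈ fixedPointSet d n A p) :
    0 < capacityRatio p V Y :=
  div_pos (Finset.prod_pos fun i _ => (posDef_sourceMatrix_of_mem hp h i).det_pos)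
    (Finset.prod_pos fun j _ => Real.rpow_pos_of_pos (h.1 j).det_pos _)

/-- After the change of bases that turns `Y` and the `M_i` into identities, the fixed point equation
is the sink condition of a geometric datum and the definition of `M_i` is its source condition. The
ratio at `Y'` is the ratio at `Y` times a diagonal quotient, which is at least `1`. -/
theorem capacityRatio_le_of_mem (hp : ∀ j, 0 < p j) (h : (V, Y) ∈ fixedPointSet d n A p)
    (hY' : ∀ j, (Y' j).PosDef) : capacityRatio p V Y ≤ capacityRatio p V Y' := by
  have hM := posDef_sourceMatrix_of_mem hp h
  have hY : ∀ j, (Y j).PosDef := h.1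
  choose G y hGdet hG hG' using fun j =>
    (hY j).exists_simultaneous_diagonalization (hY' j).isHermitian
  choose H μ hHdet hH hH' using fun i => (hM i).exists_simultaneous_diagonalization
    (isHermitian_sourceMatrix (p := p) (V := V) (fun j => (hY' j).isHermitian) i)
  have hy : ∀ j r, 0 < y j r := by
    intro j
    have := (hY' j).mul_mul_conjTranspose_same (B := ((G j)⁻¹).transpose)
      (vecMul_injective_of_isUnit ((isUnit_iff_isUnit_det _).2 (by
        rw [det_transpose]
        exact isUnit_nonsing_inv_det _ (hGdet j))))
    rw [hG' j, conjTranspose_eq_transpose_of_trivial, transpose_transpose] at this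
    have h1 : ((G j)⁻¹).transpose * (G j).transpose = 1 := by
      rw [← transpose_mul, mul_nonsing_inv _ (hGdet j), transpose_one]
    rw [Matrix.mul_assoc, Matrix.mul_assoc, mul_nonsing_inv _ (hGdet j), Matrix.mul_one,
      ← Matrix.mul_assoc, h1, Matrix.one_mul, posDef_diagonal_iff] at this
    exact this
  have hHt : ∀ i, ((H i)⁻¹).transpose * (H i).transpose = 1 := fun i => by
    rw [← transpose_mul, mul_nonsing_inv _ (hHdet i), transpose_one]
  -- The datum in bases adapted to the pairs `(Y j, Y' j)` at the sinks and to the two source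
  -- matrices at the sources.
  let W : Rep d n A := fun i j a => G j * V i j a * (H i)⁻¹
  have hWsource : ∀ (l : ∀ j, Fin (n j) → ℝ) i, sourceMatrix p W (fun j => diagonal (l j)) i =
      ((H i)⁻¹).transpose *
        sourceMatrix p V (fun j => (G j).transpose * diagonal (l j) * G j) i * (H i)⁻¹ := by
    intro l i
    simp only [sourceMatrix, W, Matrix.mul_sum, Matrix.sum_mul, Matrix.mul_smul, Matrix.smul_mul,
      transpose_mul, Matrix.mul_assoc]
  have hgeo := sum_log_le_of_geometric (V := W) (y := y) (μ := μ) hp ?_ ?_ hy ?_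
  · obtain ⟨hμ, hlog⟩ := hgeo
    have hdetM : ∀ i, (sourceMatrix p V Y' i).det =
        (sourceMatrix p V Y i).det * ∏ s, μ i s := fun i => by
      rw [hH' i, hH i, det_mul, det_mul, det_mul, det_diagonal]
      ring
    have hdetY : ∀ j, (Y' j).det = (Y j).det * ∏ r, y j r := fun j => by
      rw [hG' j, hG j, det_mul, det_mul, det_mul, det_diagonal]
      ring
    have hyprod : ∀ j, 0 < ∏ r, y j r := fun j => Finset.prod_pos fun r _ => hy j r
    have hμprod : 0 < ∏ i, ∏ s, μ i s :=
      Finset.prod_pos fun i _ => Finset.prod_pos fun s _ => hμ i s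
    have hle : ∏ j, (∏ r, y j r) ^ p j ≤ ∏ i, ∏ s, μ i s := by
      rw [← Real.log_le_log_iff (Finset.prod_pos fun j _ => Real.rpow_pos_of_pos (hyprod j) _)
        hμprod, Real.log_prod (fun j _ => (Real.rpow_pos_of_pos (hyprod j) _).ne'),
        Real.log_prod (fun i _ => (Finset.prod_pos fun s _ => hμ i s).ne')]
      convert hlog using 2 with j _ i
      · rw [Real.log_rpow (hyprod j), Real.log_prod (fun r _ => (hy j r).ne')]
      · exact Real.log_prod (fun s _ => (hμ _ s).ne')
    have hratio : capacityRatio p V Y' = capacityRatio p V Y *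
        ((∏ i, ∏ s, μ i s) / ∏ j, (∏ r, y j r) ^ p j) := by
      simp only [capacityRatio, hdetM, hdetY, Finset.prod_mul_distrib,
        Real.mul_rpow (h.1 _).det_pos.le (hyprod _).le]
      rw [mul_div_mul_comm]
    rw [hratio]
    refine le_mul_of_one_le_right (capacityRatio_nonneg hp h.1) ?_
    rwa [one_le_div (Finset.prod_pos fun j _ => Real.rpow_pos_of_pos (hyprod j) _)]
  · intro i
    -- `Y` itself corresponds to the identity diagonal.
    have := hWsource (fun j _ => 1) i
    simp only [diagonal_one, Matrix.mul_one, ← hG] at this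
    rw [show sourceMatrix p V (fun j => Y j) i = _ from hH i, ← Matrix.mul_assoc, hHt,
      Matrix.one_mul, mul_nonsing_inv _ (hHdet i)] at this
    simpa only [sourceMatrix, Matrix.mul_one] using this
  · intro j
    have hinv : ∀ i, (H i)⁻¹ * ((H i)⁻¹).transpose = (sourceMatrix p V Y i)⁻¹ := fun i => by
      rw [hH i, Matrix.mul_inv_rev, transpose_nonsing_inv]
    have := h.2.2 j
    simp only at this
    calc ∑ i, ∑ a : A i j, W i j a * (W i j a).transpose
        = G j * (∑ i, ∑ a : A i j, V i j a * (sourceMatrix p V Y i)⁻¹ * (V i j a).transpose) *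
            (G j).transpose := by
          simp only [W, ← hinv, Matrix.mul_sum, Matrix.sum_mul, transpose_mul, Matrix.mul_assoc]
      _ = G j * ((G j)⁻¹ * ((G j).transpose)⁻¹) * (G j).transpose := by
          rw [this, hG j, Matrix.mul_inv_rev]
      _ = 1 := by
          rw [← Matrix.mul_assoc, mul_nonsing_inv _ (hGdet j), Matrix.one_mul,
            nonsing_inv_mul _ (by rw [det_transpose]; exact hGdet j)]
  · intro i
    rw [hWsource]
    simp only [← hG']
    rw [show sourceMatrix p V (fun j => Y' j) i = _ from hH' i, Matrix.mul_assoc,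
      Matrix.mul_assoc, mul_nonsing_inv _ (hHdet i), Matrix.mul_one, ← Matrix.mul_assoc, hHt,
      Matrix.one_mul]

theorem capacity_eq_of_mem (hp : ∀ j, 0 < p j) (h : (V, Y) ∈ fixedPointSet d n A p) :
    capacity p V = capacityRatio p V Y := by
  refine le_antisymm (capacity_le_capacityRatio hp h.1) (le_csInf ⟨_, Y, h.1, rfl⟩ ?_)
  rintro r ⟨Z, hZ, rfl⟩
  exact capacityRatio_le_of_mem hp h hZ

/-- First-order condition: along the line `Y + t • H`, which stays positive definite for small `t`,
the logarithm of the ratio has a local minimum at `t = 0`. -/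
theorem sum_trace_eq_of_isExtremizer (hp : ∀ j, 0 < p j) (hV : IsFeasible p V)
    (hY : IsExtremizer p V Y) {H : SinkTuple n} (hH : ∀ j, (H j).IsHermitian) :
    ∑ i, ((sourceMatrix p V Y i)⁻¹ * sourceMatrix p V H i).trace =
      ∑ j, p j * ((Y j)⁻¹ * H j).trace := by
  have hpos : 0 < capacityRatio p V Y := by rw [hY.2]; exact hV
  have hdet : ∀ i, (sourceMatrix p V Y i).det ≠ 0 := by
    intro i h0
    rw [capacityRatio, Finset.prod_eq_zero (Finset.mem_univ i) h0, zero_div] at hpos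
    exact lt_irrefl _ hpos
  let f : ℝ → ℝ := fun t => ∑ i, Real.log (sourceMatrix p V Y i + t • sourceMatrix p V H i).det -
    ∑ j, p j * Real.log (Y j + t • H j).det
  have hf : HasDerivAt f (∑ i, ((sourceMatrix p V Y i)⁻¹ * sourceMatrix p V H i).trace -
      ∑ j, p j * ((Y j)⁻¹ * H j).trace) 0 :=
    (HasDerivAt.fun_sum fun i _ => hasDerivAt_log_det_add_smul (hdet i) _).sub
      (HasDerivAt.fun_sum fun j _ =>
        (hasDerivAt_log_det_add_smul (hY.1 j).det_pos.ne' _).const_mul (p j))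
  have hflog : ∀ t, (∀ j, (Y j + t • H j).PosDef) →
      f t = Real.log (capacityRatio p V fun j => Y j + t • H j) := by
    intro t ht
    have hle := capacity_le_capacityRatio (V := V) hp ht
    have hpos' : 0 < capacityRatio p V fun j => Y j + t • H j := lt_of_lt_of_le hV hle
    have hne : ∀ i, (sourceMatrix p V (fun j => Y j + t • H j) i).det ≠ 0 := by
      intro i h0
      rw [capacityRatio, Finset.prod_eq_zero (Finset.mem_univ i) h0, zero_div] at hpos'
      exact lt_irrefl _ hpos'
    have hrp : ∀ j, 0 < (Y j + t • H j).det ^ p j := fun j =>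
      Real.rpow_pos_of_pos (ht j).det_pos _
    rw [capacityRatio, Real.log_div (Finset.prod_ne_zero_iff.2 fun i _ => hne i)
      (Finset.prod_pos fun j _ => hrp j).ne', Real.log_prod (fun i _ => hne i),
      Real.log_prod (fun j _ => (hrp j).ne')]
    simp only [sourceMatrix_add_smul, Real.log_rpow (ht _).det_pos, f]
  have hmin : IsLocalMin f 0 := by
    have hev : ∀ᶠ t : ℝ in nhds 0, ∀ j, (Y j + t • H j).PosDef :=
      Filter.eventually_all.2 fun j => (hY.1 j).eventually_posDef_add_smul (hH j)
    filter_upwards [hev] with t ht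
    rw [hflog t ht, hflog 0 hev.self_of_nhds]
    simp only [zero_smul, add_zero]
    refine Real.log_le_log hpos ?_
    rw [show capacityRatio p V (fun j => Y j) = capacity p V from hY.2]
    exact capacity_le_capacityRatio hp ht
  exact sub_eq_zero.1 (hmin.hasDerivAt_eq_zero hf)

theorem mem_fixedPointSet_of_isExtremizer (hp : ∀ j, 0 < p j) (hV : IsFeasible p V)
    (hY : IsExtremizer p V Y) : (V, Y) ∈ fixedPointSet d n A p := by
  have hpos : 0 < capacityRatio p V Y := by rw [hY.2]; exact hV
  have hdet : ∀ i, (sourceMatrix p V Y i).det ≠ 0 := by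
    intro i h0
    rw [capacityRatio, Finset.prod_eq_zero (Finset.mem_univ i) h0, zero_div] at hpos
    exact lt_irrefl _ hpos
  refine ⟨hY.1, fun i => (isUnit_iff_isUnit_det _).2 (hdet i).isUnit, fun j => ?_⟩
  simp only
  set Q := ∑ i, ∑ a : A i j, V i j a * (sourceMatrix p V Y i)⁻¹ * (V i j a).transpose with hQ
  -- Vary `Y` at the single sink `j`, divide by `p j`, and move `K` to the end by cyclicity of the
  -- trace.
  have htrace : ∀ K : Matrix (Fin (n j)) (Fin (n j)) ℝ, K.IsHermitian →
      (Q * K).trace = ((Y j)⁻¹ * K).trace := by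
    intro K hK
    have := sum_trace_eq_of_isExtremizer hp hV hY (H := Pi.single j K) (by
      intro j'
      rcases eq_or_ne j' j with rfl | hne
      · simpa using hK
      · simp [hne])
    have hM : ∀ i, sourceMatrix p V (Pi.single j K) i =
        p j • ∑ a : A i j, (V i j a).transpose * K * V i j a := by
      intro i
      rw [sourceMatrix, Finset.sum_eq_single j]
      · simp
      · intro j' _ hne
        simp [hne]
      · simp
    rw [Finset.sum_eq_single j (fun j' _ hne => by simp [hne]) (by simp)] at this
    simp only [hM, Matrix.mul_smul, trace_smul, smul_eq_mul, ← Finset.mul_sum,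
      Pi.single_eq_same] at this
    rw [← mul_left_cancel₀ (hp j).ne' this, hQ]
    simp only [Matrix.sum_mul, Matrix.mul_sum, trace_sum]
    refine Finset.sum_congr rfl fun i _ => Finset.sum_congr rfl fun a _ => ?_
    rw [Matrix.mul_assoc, Matrix.mul_assoc, trace_mul_comm, Matrix.mul_assoc, Matrix.mul_assoc]
  have hinv : ∀ i, ((sourceMatrix p V Y i)⁻¹).transpose = (sourceMatrix p V Y i)⁻¹ := fun i => by
    have := (isHermitian_sourceMatrix (p := p) (V := V) (fun j => (hY.1 j).isHermitian) i).inv.eq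
    rwa [conjTranspose_eq_transpose_of_trivial] at this
  have hQt : Q.IsHermitian := by
    unfold IsHermitian
    rw [conjTranspose_eq_transpose_of_trivial]
    simp only [hQ, transpose_sum, transpose_mul, transpose_transpose, hinv, Matrix.mul_assoc]
  have hK : (Q - (Y j)⁻¹).IsHermitian := hQt.sub (hY.1 j).isHermitian.inv
  -- Testing with the symmetric matrix `K = Q - (Y j)⁻¹` itself shows that its Frobenius norm
  -- vanishes.
  have h0 : ((Q - (Y j)⁻¹).conjTranspose * (Q - (Y j)⁻¹)).trace = 0 := by
    rw [hK.eq, Matrix.sub_mul, trace_sub, htrace _ hK, sub_self]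
  exact sub_eq_zero.1 (trace_conjTranspose_mul_self_eq_zero_iff.1 h0)

theorem extremizableSet_eq_image_fst (hp : ∀ j, 0 < p j) :
    extremizableSet d n A p = Prod.fst '' fixedPointSet d n A p := by
  ext V
  constructor
  · rintro ⟨hV, Y, hY⟩
    exact ⟨(V, Y), mem_fixedPointSet_of_isExtremizer hp hV hY, rfl⟩
  · rintro ⟨⟨V, Y⟩, h, rfl⟩
    have := capacity_eq_of_mem hp h
    exact ⟨(capacityRatio_pos_of_mem hp h).trans_eq this.symm, Y, h.1, this.symm⟩

end Capacity

end QuiverBL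

/-! ### Polynomial functions and matrix equations between them -/

section PolynomialFunctions

/-- Functions on `ℝ^ι` given by polynomials. -/
def IsPolyFun {ι : Type*} (f : (ι → ℝ) → ℝ) : Prop :=
  ∃ P : MvPolynomial ι ℝ, ∀ x, MvPolynomial.eval x P = f x

variable {ι : Type*}

theorem IsPolyFun.coord (i : ι) : IsPolyFun fun x : ι → ℝ => x i :=
  ⟨MvPolynomial.X i, fun _ => MvPolynomial.eval_X i⟩

theorem IsPolyFun.const (c : ℝ) : IsPolyFun fun _ : ι → ℝ => c :=
  ⟨MvPolynomial.C c, fun _ => MvPolynomial.eval_C c⟩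

theorem IsPolyFun.mul {f g : (ι → ℝ) → ℝ} (hf : IsPolyFun f) (hg : IsPolyFun g) :
    IsPolyFun fun x => f x * g x := by
  obtain ⟨P, hP⟩ := hf
  obtain ⟨Q, hQ⟩ := hg
  exact ⟨P * Q, fun x => by rw [map_mul, hP, hQ]⟩

theorem IsPolyFun.sum {β : Type*} {s : Finset β} {f : β → (ι → ℝ) → ℝ}
    (hf : ∀ b, IsPolyFun (f b)) : IsPolyFun fun x => ∑ b ∈ s, f b x := by
  choose P hP using hf
  exact ⟨∑ b ∈ s, P b, fun x => by simp only [map_sum, hP]⟩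

theorem IsPolyFun.isSemialgebraic_eq {f g : (ι → ℝ) → ℝ} (hf : IsPolyFun f) (hg : IsPolyFun g) :
    IsSemialgebraic {x | f x = g x} := by
  obtain ⟨P, hP⟩ := hf
  obtain ⟨Q, hQ⟩ := hg
  refine SignDetermined.isSemialgebraic (C := {P - Q}) fun x y hxy hx => ?_
  have := hxy _ (Finset.mem_singleton_self _)
  rw [map_sub (MvPolynomial.eval x), map_sub (MvPolynomial.eval y), hP, hQ, hP, hQ,
    sub_eq_zero.2 hx, sign_zero, eq_comm,
    sign_eq_zero_iff] at this
  exact sub_eq_zero.1 this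

/-- Matrix-valued functions on `ℝ^ι` whose entries are given by polynomials. -/
def IsPolyMatrixFun {α β : Type*} (M : (ι → ℝ) → Matrix α β ℝ) : Prop :=
  ∀ r c, IsPolyFun fun x => M x r c

namespace IsPolyMatrixFun

variable {α β γ : Type*}

theorem const (M : Matrix α β ℝ) : IsPolyMatrixFun fun _ : ι → ℝ => M :=
  fun r c => .const (M r c)

theorem transpose {M : (ι → ℝ) → Matrix α β ℝ} (hM : IsPolyMatrixFun M) :
    IsPolyMatrixFun fun x => (M x).transpose :=
  fun r c => hM c r

theorem mul [Fintype β] {M : (ι → ℝ) → Matrix α β ℝ} {N : (ι → ℝ) → Matrix β γ ℝ}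
    (hM : IsPolyMatrixFun M) (hN : IsPolyMatrixFun N) : IsPolyMatrixFun fun x => M x * N x :=
  fun r c => .sum fun b => (hM r b).mul (hN b c)

theorem smul {M : (ι → ℝ) → Matrix α β ℝ} (hM : IsPolyMatrixFun M) (t : ℝ) :
    IsPolyMatrixFun fun x => t • M x :=
  fun r c => (IsPolyFun.const t).mul (hM r c)

theorem sum {δ : Type*} {s : Finset δ} {M : δ → (ι → ℝ) → Matrix α β ℝ}
    (hM : ∀ b, IsPolyMatrixFun (M b)) : IsPolyMatrixFun fun x => ∑ b ∈ s, M b x := by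
  intro r c
  simp only [Matrix.sum_apply]
  exact .sum fun b => hM b r c

theorem isSemialgebraic_eq [Finite α] [Finite β] {M N : (ι → ℝ) → Matrix α β ℝ}
    (hM : IsPolyMatrixFun M) (hN : IsPolyMatrixFun N) : IsSemialgebraic {x | M x = N x} := by
  have := IsSemialgebraic.iInter fun r => IsSemialgebraic.iInter fun c =>
    (hM r c).isSemialgebraic_eq (hN r c)
  convert this using 1
  ext x
  simp only [Set.mem_iInter, Set.mem_ofPred_eq]
  exact Matrix.ext_iff.symm

end IsPolyMatrixFun

end PolynomialFunctions

/-! ### Semi-algebraicity of the fixed point set and of its projection -/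

namespace QuiverBL

open Matrix

section Semialgebraic

variable {k m : ℕ} {d : Fin k → ℕ} {n : Fin m → ℕ} {A : Fin k → Fin m → Type u}
  [∀ i j, Fintype (A i j)] {p : Fin m → ℝ}

/-- Only polynomial equations remain once inverses and Gram factors are unknowns. The factorization
gives semidefiniteness of `Y j`, and the last equation makes `Y j` invertible, hence positive
definite. -/
theorem mem_fixedPointSet_iff {V : Rep d n A} {Y : SinkTuple n} :
    (V, Y) ∈ fixedPointSet d n A p ↔
      ∃ (N : SinkTuple d) (L : SinkTuple n), (∀ j, Y j = (L j).transpose * L j) ∧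
        (∀ i, sourceMatrix p V Y i * N i = 1) ∧
        ∀ j, (∑ i, ∑ a : A i j, V i j a * N i * (V i j a).transpose) * Y j = 1 := by
  constructor
  · rintro ⟨hY, hM, hfix⟩
    choose L hL using fun j => (hY j).posSemidef.exists_eq_transpose_mul_self
    refine ⟨fun i => (sourceMatrix p V Y i)⁻¹, L, hL, fun i =>
      mul_nonsing_inv _ ((isUnit_iff_isUnit_det _).1 (hM i)), fun j => ?_⟩
    rw [hfix j, nonsing_inv_mul _ (hY j).det_pos.ne'.isUnit]
  · rintro ⟨N, L, hL, hN, hfix⟩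
    have hinv : ∀ i, (sourceMatrix p V Y i)⁻¹ = N i := fun i => inv_eq_right_inv (hN i)
    refine ⟨fun j => ?_, fun i => IsUnit.of_mul_eq_one _ (hN i), fun j => ?_⟩
    · have hpsd : (Y j).PosSemidef := by
        rw [hL j, ← conjTranspose_eq_transpose_of_trivial]
        exact posSemidef_conjTranspose_mul_self _
      exact hpsd.posDef_iff_isUnit.2 (IsUnit.of_mul_eq_one_right _ (hfix j))
    · simp only [hinv]
      exact (inv_eq_left_inv (hfix j)).symm

theorem isSemialgebraic_image_fixedPointSet :
    IsSemialgebraic (pairCoords d n A '' fixedPointSet d n A p) := by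
  let Vf : ((RepIndex d n A ⊕ SinkIndex n) ⊕ (SinkIndex d ⊕ SinkIndex n) → ℝ) → Rep d n A :=
    fun x => (repCoords d n A).symm fun i => x (Sum.inl (Sum.inl i))
  let Yf : ((RepIndex d n A ⊕ SinkIndex n) ⊕ (SinkIndex d ⊕ SinkIndex n) → ℝ) → SinkTuple n :=
    fun x => (sinkCoords n).symm fun i => x (Sum.inl (Sum.inr i))
  let Nf : ((RepIndex d n A ⊕ SinkIndex n) ⊕ (SinkIndex d ⊕ SinkIndex n) → ℝ) → SinkTuple d :=
    fun x => (sinkCoords d).symm fun i => x (Sum.inr (Sum.inl i))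
  let Lf : ((RepIndex d n A ⊕ SinkIndex n) ⊕ (SinkIndex d ⊕ SinkIndex n) → ℝ) → SinkTuple n :=
    fun x => (sinkCoords n).symm fun i => x (Sum.inr (Sum.inr i))
  have hV : ∀ i j a, IsPolyMatrixFun fun x => Vf x i j a := fun i j a r c => .coord _
  have hY : ∀ j, IsPolyMatrixFun fun x => Yf x j := fun j r c => .coord _
  have hN : ∀ i, IsPolyMatrixFun fun x => Nf x i := fun i r c => .coord _
  have hL : ∀ j, IsPolyMatrixFun fun x => Lf x j := fun j r c => .coord _
  have hM : ∀ i, IsPolyMatrixFun fun x => sourceMatrix p (Vf x) (Yf x) i := fun i =>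
    .sum fun j => .smul (.sum fun a => ((hV i j a).transpose.mul (hY j)).mul (hV i j a)) (p j)
  have hQ : ∀ j, IsPolyMatrixFun fun x =>
      ∑ i, ∑ a : A i j, Vf x i j a * Nf x i * (Vf x i j a).transpose := fun j =>
    .sum fun i => .sum fun a => ((hV i j a).mul (hN i)).mul (hV i j a).transpose
  have h1 := IsSemialgebraic.iInter fun j =>
    (hY j).isSemialgebraic_eq ((hL j).transpose.mul (hL j))
  have h2 := IsSemialgebraic.iInter fun i =>
    ((hM i).mul (hN i)).isSemialgebraic_eq (.const 1)
  have h3 := IsSemialgebraic.iInter fun j =>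
    ((hQ j).mul (hY j)).isSemialgebraic_eq (.const 1)
  -- The second block of coordinates holds the auxiliary `N` and `L`, which are projected away.
  convert (h1.inter (h2.inter h3)).exists_sumElim using 1
  ext z
  obtain ⟨⟨V, Y⟩, rfl⟩ := (pairCoords d n A).surjective z
  rw [Set.mem_image_equiv, Equiv.symm_apply_apply, mem_fixedPointSet_iff]
  simp only [Set.mem_ofPred_eq, Set.mem_inter_iff, Set.mem_iInter]
  constructor
  · rintro ⟨N, L, h⟩
    exact ⟨Sum.elim (sinkCoords d N) (sinkCoords n L), h⟩
  · rintro ⟨w, h⟩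
    exact ⟨(sinkCoords d).symm fun i => w (Sum.inl i),
      (sinkCoords n).symm fun i => w (Sum.inr i), h⟩

/-- A second projection, now along the coordinates of `Y`. -/
theorem isSemialgebraic_image_fst_fixedPointSet :
    IsSemialgebraic (repCoords d n A '' (Prod.fst '' fixedPointSet d n A p)) := by
  convert (isSemialgebraic_image_fixedPointSet (d := d) (n := n) (A := A)
    (p := p)).exists_sumElim using 1
  ext v
  simp only [Set.mem_ofPred_eq]
  constructor
  · rintro ⟨_, ⟨⟨V, Y⟩, h, rfl⟩, rfl⟩
    exact ⟨sinkCoords n Y, (V, Y), h, rfl⟩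
  · rintro ⟨w, ⟨V, Y⟩, h, he⟩
    refine ⟨V, ⟨(V, Y), h, rfl⟩, ?_⟩
    funext x
    exact congrFun he (Sum.inl x)

end Semialgebraic

end QuiverBL

theorem theorem3p1 {k m : ℕ} (hk : 0 < k) (hm : 0 < m)
    (d : Fin k → ℕ) (hd : ∀ i, 0 < d i) (n : Fin m → ℕ) (hn : ∀ j, 0 < n j)
    (p : Fin m → ℝ) (hp : ∀ j, 0 < p j)
    (hdim : ∑ i, (d i : ℝ) = ∑ j, p j * (n j : ℝ))
    (A : Fin k → Fin m → Type u) [∀ i j, Fintype (A i j)] :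
    IsSemialgebraic (QuiverBL.pairCoords d n A '' QuiverBL.fixedPointSet d n A p) ∧
    QuiverBL.extremizableSet d n A p = Prod.fst '' QuiverBL.fixedPointSet d n A p ∧
    IsSemialgebraic (QuiverBL.repCoords d n A '' QuiverBL.extremizableSet d n A p) ∧
    ∀ (V : QuiverBL.Rep d n A) (Y : QuiverBL.SinkTuple n),
      (V, Y) ∈ QuiverBL.fixedPointSet d n A p →
      QuiverBL.capacity p V =
        (∏ i, (QuiverBL.sourceMatrix p V Y i).det) / ∏ j, (Y j).det ^ p j :=
  ⟨QuiverBL.isSemialgebraic_image_fixedPointSet, QuiverBL.extremizableSet_eq_image_fst hp,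
    QuiverBL.extremizableSet_eq_image_fst (A := A) (d := d) hp ▸
      QuiverBL.isSemialgebraic_image_fst_fixedPointSet,
    fun _ _ h => QuiverBL.capacity_eq_of_mem hp h⟩
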